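/- **Model.** Let $D>1$, $k\ge 1$, and let $E$ be a Euclidean space of arbitrary finite dimension with distance $d$. Fix an initial configuration of $k$ points of $E$, from which all algorithms and all offline solutions start. In each time step $t=1,\dots,n$ a request $r_t\in E$ is revealed; then the $k$ servers $a_1,\dots,a_k$ are moved to new positions $a_1',\dots,a_k'$, and the cost of the step is $D\sum_{i}d(a_i,a_i')+\min_i d(a_i',r_t)$. In the *$k$-Page Migration Problem* the servers (called pages) may move arbitrarily. In the *$k$-Mobile Server Problem* with parameters $m_s>0$ and $m_c$, consecutive requests satisfy $d(r_t,r_{t+1})\le m_c$, and an offline solution moves each server by at most $m_s$ per step; the online algorithm may move each server by at most $(1+\delta)m_s$ per step, where $0<\delta<1$. A deterministic online algorithm is *$\rho$-competitive* if there is a constant $\alpha$, independent of the request sequence and of its length, such that on every input its cost is at most $\rho\,C_{Opt}+\alpha$, where $C_{Opt}$ is the optimal offline cost of that input. **Projection.** Let $\mathcal K$ be a deterministic online algorithm for $k$-Page Migration with pages $c_i$, and for a request $r$ let $inner(r)$ be the closed ball around $r$ of radius $16kDm_c$. The first phase starts with $r_1$; a phase that started with the request $r_s$ ends, and a new phase starts,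 with the first later request $r_t$ such that $d(r_s,r_t)\ge 16kDm_c$. The projected algorithm $\hat{\mathcal K}$ has pages $\hat c_i$, starting in the initial configuration. In step $t$, if $c_i'\in inner(r_t)$ then $\hat c_i'=c_i'$; otherwise, $\hat c_i'$ is the point of the boundary of $inner(r_t)$ closest to $c_i'$ if a phase starts with $r_t$, and $\hat c_i'=\hat c_i$ if not. **Algorithm WMS** (for $m_c\ge(1+\delta)m_s$). On the request $r'$, simulate the next step of $\hat{\mathcal K}$ and compute a minimum weight matching (the weights are the distances) between the servers $a_1,\dots,a_k$ and the new positions $\hat c_1',\dots,\hat c_k'$. Let $\tilde a$ be a server closest to $r'$. Tentatively move $\tilde a$ straight towards $r'$ by the distance $\min\bigl((1+\tfrac\delta2)m_s,\tfrac1D(1-\tfrac\delta2)d(\tilde a,r')\bigr)$, and every other server straight towards its partner in the matching by the distance $\min\bigl((1+\delta)m_s,\tfrac1D d(\tilde a,r')\bigr)$, stopping at the partner if it is reached. If after this move some other server is strictly closer to $r'$ than $\tilde a$, the tentative move is discarded, and instead all servers (including $\tilde a$) move straight towards their partners by the distance $(1+\delta)m_s$, stopping there if they are reached. Ties in the choice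 of the matching and of $\tilde a$ are resolved by an arbitrary fixed rule. **Theorem.** There is an absolute constant $C>0$ such that the following holds for all dimensions, all $k\ge1$, $D>1$, $m_s>0$, $0<\delta<1$, $m_c\ge(1+\delta)m_s$, all initial configurations and all tie-breaking rules. If $\mathcal K$ is a $c(\mathcal K)$-competitive deterministic online algorithm for $k$-Page Migration (on arbitrary request sequences), then WMS never moves a server by more than $(1+\delta)m_s$ in a step, and it is $$C\left(\frac{1}{\delta^4}\,k^2\,\frac{m_c}{m_s}+\frac{1}{\delta^3}\,k^2\,\frac{m_c}{m_s}\,c(\mathcal K)\right)\text{-competitive}$$ for the $k$-Mobile Server Problem with parameters $m_s$ and $m_c$. -/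

import Mathlib

noncomputable section

namespace MobileServer

/-- The Euclidean space of dimension `d`. -/
abbrev Pt (d : ℕ) : Type := EuclideanSpace ℝ (Fin d)

/-- A configuration: the positions of the `k` servers (or pages). -/
abbrev Config (d k : ℕ) : Type := Fin k → Pt d

/-- A request sequence; `r t` is the request that arrives in time step `t + 1`.
Only the first `n` entries matter for an input of length `n`. -/
abbrev Requests (d : ℕ) : Type := ℕ → Pt d

/-- A schedule; `s 0` is the initial configuration and `s t` the configuration at the end of
time step `t`. -/
abbrev Schedule (d k : ℕ) : Type := ℕ → Config d k

/-- Cost of the first `n` time steps: in each step the servers move from `s t` to `s (t + 1)`, at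
`D` times the total distance, and then the closest server answers the request `r t`. -/
def cost {d k : ℕ} (D : ℝ) (r : Requests d) (s : Schedule d k) (n : ℕ) : ℝ :=
  ∑ t ∈ Finset.range n,
    (D * ∑ i, dist (s t i) (s (t + 1) i) + ⨅ i, dist (s (t + 1) i) (r t))

/-- No server moves more than `m` in one time step. -/
def SpeedAtMost {d k : ℕ} (m : ℝ) (s : Schedule d k) : Prop :=
  ∀ t i, dist (s t i) (s (t + 1) i) ≤ m

/-- Cost of an optimal offline solution of `k`-Page Migration, started in `x₀`. -/
def pageOpt {d k : ℕ} (D : ℝ) (x₀ : Config d k) (r : Requests d) (n : ℕ) : ℝ :=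
  sInf {y | ∃ s : Schedule d k, s 0 = x₀ ∧ y = cost D r s n}

/-- Cost of an optimal offline solution of the `k`-Mobile Server Problem with speed limit `ms`,
started in `x₀`. -/
def mobileOpt {d k : ℕ} (D ms : ℝ) (x₀ : Config d k) (r : Requests d) (n : ℕ) : ℝ :=
  sInf {y | ∃ s : Schedule d k, s 0 = x₀ ∧ SpeedAtMost ms s ∧ y = cost D r s n}

/-- A deterministic online algorithm started in `x₀`: the configuration at the end of step `t` is
a function of the first `t` requests. -/
structure OnlineAlg {d k : ℕ} (x₀ : Config d k) where
  run : Requests d → Schedule d k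
  run_zero : ∀ r, run r 0 = x₀
  causal : ∀ r r' t, (∀ s < t, r s = r' s) → run r t = run r' t

/-- `c`-competitiveness for `k`-Page Migration. The additive constant does not depend on the
request sequence or on its length. -/
def PageCompetitive {d k : ℕ} {x₀ : Config d k} (D : ℝ) (A : OnlineAlg x₀) (c : ℝ) : Prop :=
  ∃ α : ℝ, ∀ (r : Requests d) (n : ℕ), cost D r (A.run r) n ≤ c * pageOpt D x₀ r n + α

/-- `c`-competitiveness for the `k`-Mobile Server Problem on the inputs in which consecutive
requests have distance at most `mc`, against offline solutions with speed limit `ms`. -/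
def MobileCompetitive {d k : ℕ} {x₀ : Config d k} (D ms mc : ℝ) (A : OnlineAlg x₀) (c : ℝ) :
    Prop :=
  ∃ α : ℝ, ∀ (r : Requests d) (n : ℕ), (∀ t, t + 1 < n → dist (r t) (r (t + 1)) ≤ mc) →
    cost D r (A.run r) n ≤ c * mobileOpt D ms x₀ r n + α

/-- The point reached from `x` by moving straight towards `y` by the distance `s`, stopping at `y`
if it is reached. -/
def moveToward {d : ℕ} (x y : Pt d) (s : ℝ) : Pt d :=
  if dist x y ≤ s then y else AffineMap.lineMap x y (s / dist x y)

/-! The projection of a page migration algorithm to the vicinity of the request. -/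

/-- The request at which the phase containing `r t` started: a phase ends, and the next one starts,
with the first request at distance at least `ρ` from the request that started the phase. -/
def phaseStart {d : ℕ} (ρ : ℝ) (r : Requests d) : ℕ → Pt d
  | 0 => r 0
  | t + 1 => if ρ ≤ dist (phaseStart ρ r t) (r (t + 1)) then r (t + 1) else phaseStart ρ r t

/-- A phase starts with `r t`. -/
def StartsPhase {d : ℕ} (ρ : ℝ) (r : Requests d) : ℕ → Prop
  | 0 => True
  | t + 1 => ρ ≤ dist (phaseStart ρ r t) (r (t + 1))

open Classical in
/-- The projection of the schedule `c`. A page of `c` in the closed ball of radius `ρ` around the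
request is copied. For a page outside of it, the projected page is put on the nearest point of
the sphere when a phase starts and otherwise it stays. -/
def projSchedule {d k : ℕ} (ρ : ℝ) (r : Requests d) (c : Schedule d k) : Schedule d k
  | 0 => c 0
  | t + 1 => fun i =>
      if dist (c (t + 1) i) (r t) ≤ ρ then c (t + 1) i
      else if StartsPhase ρ r t then moveToward (r t) (c (t + 1) i) ρ
      else projSchedule ρ r c t i

/-! The algorithm WMS. -/

/-- A rule that resolves the ties in WMS: it selects a minimum weight matching of two
configurations, and a server that is closest to a given point. -/
structure TieBreaking (d k : ℕ) where
  matching : Config d k → Config d k → Equiv.Perm (Fin k)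
  matching_min : ∀ (a c : Config d k) (τ : Equiv.Perm (Fin k)),
    ∑ i, dist (a i) (c (matching a c i)) ≤ ∑ i, dist (a i) (c (τ i))
  closest : Config d k → Pt d → Fin k
  closest_min : ∀ (a : Config d k) (x : Pt d) (j : Fin k), dist (a (closest a x)) x ≤ dist (a j) x

/-- The tentative move of WMS in one step, from the configuration `a`, for the simulated pages `c`
and the request `x`: `j` is the closest server, `π` the matching. -/
def greedyMove {d k : ℕ} (D ms δ : ℝ) (π : Equiv.Perm (Fin k)) (j : Fin k) (a c : Config d k)
    (x : Pt d) : Config d k := fun i =>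
  if i = j then
    moveToward (a i) x (min ((1 + δ / 2) * ms) (1 / D * (1 - δ / 2) * dist (a j) x))
  else moveToward (a i) (c (π i)) (min ((1 + δ) * ms) (1 / D * dist (a j) x))

open Classical in
/-- One step of WMS: the tentative move, unless it makes a server other than the selected one
closer to the request; in that case all servers follow the matching with full speed. -/
def wmsStep {d k : ℕ} (D ms δ : ℝ) (T : TieBreaking d k) (a c : Config d k) (x : Pt d) :
    Config d k :=
  let π := T.matching a c
  let j := T.closest a x
  let g := greedyMove D ms δ π j a c x
  if ∃ i, i ≠ j ∧ dist (g i) x < dist (g j) x then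
    fun i => moveToward (a i) (c (π i)) ((1 + δ) * ms)
  else g

/-- The schedule of WMS, when the simulated pages follow the schedule `c`. -/
def wmsSchedule {d k : ℕ} (D ms δ : ℝ) (T : TieBreaking d k) (r : Requests d)
    (c : Schedule d k) : Schedule d k
  | 0 => c 0
  | t + 1 => wmsStep D ms δ T (wmsSchedule D ms δ T r c t) (c (t + 1)) (r t)

theorem phaseStart_congr {d : ℕ} (ρ : ℝ) {r r' : Requests d} :
    ∀ t, (∀ s ≤ t, r s = r' s) → phaseStart ρ r t = phaseStart ρ r' t
  | 0, h => h 0 le_rfl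
  | t + 1, h => by
      rw [phaseStart, phaseStart, phaseStart_congr ρ t fun s hs => h s (by omega),
        h (t + 1) le_rfl]

theorem startsPhase_congr {d : ℕ} (ρ : ℝ) {r r' : Requests d} :
    ∀ t, (∀ s ≤ t, r s = r' s) → (StartsPhase ρ r t ↔ StartsPhase ρ r' t)
  | 0, _ => Iff.rfl
  | t + 1, h => by
      rw [StartsPhase, StartsPhase, phaseStart_congr ρ t fun s hs => h s (by omega),
        h (t + 1) le_rfl]

/-- The projection of an online algorithm for `k`-Page Migration, for the radius
`16 * k * D * mc`. -/
def OnlineAlg.project {d k : ℕ} {x₀ : Config d k} (D mc : ℝ) (K : OnlineAlg x₀) :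
    OnlineAlg x₀ where
  run r := projSchedule (16 * k * D * mc) r (K.run r)
  run_zero r := K.run_zero r
  causal r r' t := by
    induction t with
    | zero => intro _; simp only [projSchedule, K.run_zero]
    | succ t ih =>
      intro h
      have hp : StartsPhase (16 * k * D * mc) r t ↔ StartsPhase (16 * k * D * mc) r' t :=
        startsPhase_congr _ t fun s hs => h s (by omega)
      funext i
      have ih := ih fun s hs => h s (by omega)
      simp only [projSchedule]
      rw [ih, K.causal r r' (t + 1) h, h t (by omega)]
      by_cases hq : StartsPhase (16 * k * D * mc) r t
      · rw [if_pos hq, if_pos (hp.1 hq)]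
      · rw [if_neg hq, if_neg fun h' => hq (hp.2 h')]

/-- The algorithm WMS for the case `(1 + δ) * ms ≤ mc`: it simulates the projection of the
`k`-Page Migration algorithm `K`. -/
def WMS {d k : ℕ} {x₀ : Config d k} (D ms mc δ : ℝ) (T : TieBreaking d k) (K : OnlineAlg x₀) :
    OnlineAlg x₀ where
  run r := wmsSchedule D ms δ T r ((K.project D mc).run r)
  run_zero r := (K.project D mc).run_zero r
  causal r r' t := by
    induction t with
    | zero => intro _; simp only [wmsSchedule, OnlineAlg.run_zero]
    | succ t ih =>
      intro h
      simp only [wmsSchedule]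
      rw [ih fun s hs => h s (by omega), (K.project D mc).causal r r' (t + 1) h, h t (by omega)]

/-- Ties can always be broken. -/
theorem nonempty_tieBreaking (d k : ℕ) (hk : 0 < k) : Nonempty (TieBreaking d k) := by
  have : Nonempty (Fin k) := ⟨⟨0, hk⟩⟩
  choose m hm using fun a c : Config d k =>
    Finite.exists_min fun τ : Equiv.Perm (Fin k) => ∑ i, dist (a i) (c (τ i))
  choose j hj using fun (a : Config d k) (x : Pt d) => Finite.exists_min fun i => dist (a i) x
  exact ⟨⟨m, hm, j, hj⟩⟩

end MobileServer

end

namespace MobileServer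

/-! Geometry of a straight move. -/

/-! The cost of WMS is charged partly to the simulated page schedule and partly, directly, to an
offline schedule of speed `ms`. Write `ρ = 16 * k * D * mc`.

Projection. A projected page moves more than the original page only when a phase starts, and then by
`O(ρ)`, apart from an initial term. While the request travels by `ρ`, every schedule pays at least
`D * ρ / 2`: between the first and the last time that a server is near the request, the request is
displaced by little more than that server moves (`dist_request_le`, `mul_dist_request_le_cost`). So
phases are paid by the page schedule itself, at a loss of a factor `O(k)`, and the projected pages
stay within `3 * ρ` of the request.

Amortization. The potential is `Y * D` times the matching weight (`wmsStep_cost_le`). In a tentative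
move the followers are faster than the selected server by a factor governed by `δ`, so either the
weight falls enough or the simulated service cost is comparable with the distance `X` of the
selected server. The speed limit bounds the fall of the weight, so this handles `X` only up to a
threshold of order `ρ / δ`. That forces `Y` to be of order `k * mc / (δ ^ 2 * ms)`; the service
coefficient `12 * Y / δ` and the factor `k` from the projection then give the term with `c`.

Far steps. Larger `X` are paid by a quadratic potential in `X` and by the offline schedule
(`sum_farDist_Ico_le`). As long as the request stays near one point, the servers approach it at
speed `(1 + δ / 4) * ms`. If the request is on average slower than `(1 + δ / 8) * ms`, then `X`
falls and the potential pays. If it is faster and travels far, it outruns the offline servers, which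
pay an amount quadratic in its displacement (`mul_sq_dist_request_le_cost`).

Start. The additive constant must not depend on the first request. If that request is far away, a
long input makes the reference schedules pay for the initial terms, and on a short input all
schedules of bounded speed cost about the same (`cost_wms_le`). -/

theorem exists_moveToward_eq {d : ℕ} (x y : Pt d) {s : ℝ} (hs : 0 ≤ s) :
    ∃ θ : ℝ, 0 ≤ θ ∧ θ ≤ 1 ∧ moveToward x y s = AffineMap.lineMap x y θ ∧
      θ * dist x y = min s (dist x y) := by
  unfold moveToward
  split_ifs with h
  · exact ⟨1, zero_le_one, le_rfl, by simp, by rw [min_eq_right h, one_mul]⟩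
  · push Not at h
    have hd : 0 < dist x y := hs.trans_lt h
    exact ⟨s / dist x y, by positivity, (div_le_one hd).2 h.le, rfl,
      by rw [min_eq_left h.le, div_mul_cancel₀ _ hd.ne']⟩

theorem dist_self_moveToward {d : ℕ} (x y : Pt d) {s : ℝ} (hs : 0 ≤ s) :
    dist x (moveToward x y s) = min s (dist x y) := by
  obtain ⟨θ, h0, _, h, hm⟩ := exists_moveToward_eq x y hs
  rw [h, dist_left_lineMap, Real.norm_of_nonneg h0, hm]

theorem dist_moveToward_target {d : ℕ} (x y : Pt d) {s : ℝ} (hs : 0 ≤ s) :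
    dist (moveToward x y s) y = dist x y - min s (dist x y) := by
  obtain ⟨θ, _, h1, h, hm⟩ := exists_moveToward_eq x y hs
  rw [h, dist_lineMap_right, Real.norm_of_nonneg (by linarith)]
  linarith

theorem moveToward_eq_target {d : ℕ} {x y : Pt d} {s : ℝ} (h : dist x y ≤ s) :
    moveToward x y s = y := if_pos h

theorem dist_lineMap_le {d : ℕ} (x y z : Pt d) {θ : ℝ} (h0 : 0 ≤ θ) (h1 : θ ≤ 1) :
    dist (AffineMap.lineMap x y θ : Pt d) z ≤ (1 - θ) * dist x z + θ * dist y z := by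
  have : (AffineMap.lineMap x y θ : Pt d) - z = (1 - θ) • (x - z) + θ • (y - z) := by
    rw [AffineMap.lineMap_apply_module]
    module
  rw [dist_eq_norm, this]
  refine (norm_add_le _ _).trans_eq ?_
  rw [norm_smul, norm_smul, Real.norm_of_nonneg h0, Real.norm_of_nonneg (by linarith),
    dist_eq_norm, dist_eq_norm]

/-- Moving towards `y` brings one closer to every point `z` near `y`. -/
theorem dist_moveToward_le {d : ℕ} (x y z : Pt d) {s : ℝ} (hs : 0 ≤ s) :
    dist (moveToward x y s) z * dist x y ≤
      dist x z * dist x y - min s (dist x y) * (dist x z - dist y z) := by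
  obtain ⟨θ, h0, h1, h, hm⟩ := exists_moveToward_eq x y hs
  have := mul_le_mul_of_nonneg_right (dist_lineMap_le x y z h0 h1) (dist_nonneg (x := x) (y := y))
  rw [h, ← hm]
  nlinarith

/-! Step costs. -/

/-- Total distance moved in step `t`. -/
noncomputable def moved {d k : ℕ} (s : Schedule d k) (t : ℕ) : ℝ := ∑ i, dist (s t i) (s (t + 1) i)

/-- Service cost of step `t`. -/
noncomputable def service {d k : ℕ} (r : Requests d) (s : Schedule d k) (t : ℕ) : ℝ :=
  ⨅ i, dist (s (t + 1) i) (r t)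

/-- Cost of step `t`. -/
noncomputable def stepCost {d k : ℕ} (D : ℝ) (r : Requests d) (s : Schedule d k) (t : ℕ) : ℝ :=
  D * moved s t + service r s t

theorem cost_eq_sum {d k : ℕ} (D : ℝ) (r : Requests d) (s : Schedule d k) (n : ℕ) :
    cost D r s n = ∑ t ∈ Finset.range n, stepCost D r s t := rfl

section
variable {d k : ℕ} (r : Requests d) (s : Schedule d k) (t : ℕ)

theorem moved_nonneg : 0 ≤ moved s t := Finset.sum_nonneg fun _ _ => dist_nonneg

theorem dist_le_moved (i : Fin k) : dist (s t i) (s (t + 1) i) ≤ moved s t :=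
  Finset.single_le_sum (f := fun i => dist (s t i) (s (t + 1) i)) (fun _ _ => dist_nonneg)
    (Finset.mem_univ i)

theorem service_nonneg : 0 ≤ service r s t := Real.iInf_nonneg fun _ => dist_nonneg

theorem service_le (i : Fin k) : service r s t ≤ dist (s (t + 1) i) (r t) :=
  ciInf_le (Set.finite_range _).bddBelow i

theorem exists_service_eq (hk : 0 < k) : ∃ i, dist (s (t + 1) i) (r t) = service r s t := by
  have : Nonempty (Fin k) := ⟨⟨0, hk⟩⟩
  exact exists_eq_ciInf_of_finite

theorem le_service (hk : 0 < k) {y : ℝ} (h : ∀ i, y ≤ dist (s (t + 1) i) (r t)) :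
    y ≤ service r s t := by
  have : Nonempty (Fin k) := ⟨⟨0, hk⟩⟩
  exact le_ciInf h

theorem mul_moved_le_stepCost (D : ℝ) : D * moved s t ≤ stepCost D r s t :=
  le_add_of_nonneg_right (service_nonneg r s t)

theorem stepCost_nonneg {D : ℝ} (hD : 1 < D) : 0 ≤ stepCost D r s t :=
  add_nonneg (mul_nonneg (by linarith) (moved_nonneg s t)) (service_nonneg r s t)

theorem service_le_stepCost {D : ℝ} (hD : 1 < D) : service r s t ≤ stepCost D r s t :=
  le_add_of_nonneg_left (mul_nonneg (by linarith) (moved_nonneg s t))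

theorem cost_nonneg {D : ℝ} (hD : 1 < D) (n : ℕ) : 0 ≤ cost D r s n :=
  Finset.sum_nonneg fun t _ => stepCost_nonneg r s t hD

end

/-! ### Covering the path of the request by the servers. -/

theorem dist_le_sum_moves {d k : ℕ} (o : Schedule d k) (w : ℕ → ℝ)
    (hw : ∀ t i, dist (o t i) (o (t + 1) i) ≤ w t) (i : Fin k) {s e : ℕ} (h : s ≤ e) :
    dist (o s i) (o e i) ≤ ∑ u ∈ Finset.Ico s e, w u :=
  dist_le_Ico_sum_of_dist_le (f := fun t => o t i) h fun _ _ => hw _ i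

open Classical in
/-- If the schedule `o` comes `y`-close to the request in all but few steps, then the request
cannot move much further than the servers of `o` do. -/
theorem dist_request_le {d k : ℕ} (o : Schedule d k) (r : Requests d) (w : ℕ → ℝ) {mc y : ℝ}
    (hmc : 0 ≤ mc) (hy : 0 ≤ y)
    (hw : ∀ t i, dist (o t i) (o (t + 1) i) ≤ w t) (hr : ∀ t, dist (r t) (r (t + 1)) ≤ mc)
    (hw0 : ∀ t, 0 ≤ w t) {e : ℕ} (m : ℕ) :
    ∀ (S : Finset (Fin k)) (s : ℕ), s + m = e →
      (∀ u, s ≤ u → u < e → ∀ i, dist (o (u + 1) i) (r u) < y → i ∈ S) →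
      dist (r s) (r e) ≤ S.card * (2 * y + mc) +
        mc * ((Finset.Ico s e).filter fun u => ∀ i, y ≤ dist (o (u + 1) i) (r u)).card +
        ∑ u ∈ Finset.Ico s e, w u := by
  -- `S` contains the servers that may still come close. The time intervals used for different
  -- servers are disjoint, so `w` is counted once and not `k` times.
  induction m using Nat.strong_induction_on with
  | _ m ih =>
  intro S s hse hS
  rcases Nat.eq_zero_or_pos m with rfl | hm
  · obtain rfl : s = e := by simpa using hse
    simp only [dist_self, Finset.Ico_self, Finset.filter_empty, Finset.card_empty,
      Finset.sum_empty, Nat.cast_zero, mul_zero, add_zero]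
    positivity
  have hlt : s < e := by omega
  by_cases hc : ∀ i, y ≤ dist (o (s + 1) i) (r s)
  · have h1 := ih (m - 1) (by omega) S (s + 1) (by omega) fun u hu => hS u (by omega)
    have h2 := dist_triangle (r s) (r (s + 1)) (r e)
    have h3 := hr s
    rw [← Finset.insert_Ico_add_one_left_eq_Ico hlt, Finset.filter_insert, if_pos hc,
      Finset.card_insert_of_notMem (by simp), Finset.sum_insert (by simp)]
    push_cast
    linarith [hw0 s]
  · push Not at hc
    obtain ⟨i, hi⟩ := hc
    -- Jump to the last step `q` in which server `i` is close. The jump costs `2 * y + mc` plus the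
    -- motion of `i`, and `i` can be removed from `S` afterwards.
    set P : ℕ → Prop := fun u => s ≤ u ∧ dist (o (u + 1) i) (r u) < y with hP
    have hPs : P s := ⟨le_rfl, hi⟩
    set q := Nat.findGreatest P (e - 1) with hq
    have hqP : P q := Nat.findGreatest_spec (P := P) (by omega : s ≤ e - 1) hPs
    have hqe : q ≤ e - 1 := Nat.findGreatest_le _
    have hmax : ∀ u, q < u → u ≤ e - 1 → ¬ P u := fun u h1 h2 =>
      Nat.findGreatest_is_greatest h1 h2
    have hiS : i ∈ S := hS s le_rfl hlt i hi
    have h1 := ih (e - (q + 1)) (by have := hqP.1; omega) (S.erase i) (q + 1) (by omega)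
      fun u hu hue j hj => by
        refine Finset.mem_erase.2 ⟨?_, hS u (by have := hqP.1; omega) hue j hj⟩
        rintro rfl
        exact hmax u (by omega) (by omega) ⟨by have := hqP.1; omega, hj⟩
    have h2 : dist (o (s + 1) i) (o (q + 1) i) ≤ ∑ u ∈ Finset.Ico s (q + 1), w u :=
      (dist_le_sum_moves o w hw i (by have := hqP.1; omega)).trans
        (Finset.sum_le_sum_of_subset_of_nonneg (Finset.Ico_subset_Ico_left (by omega))
          fun u _ _ => hw0 u)
    have h3 : dist (r s) (r e) ≤ dist (o (s + 1) i) (r s) + dist (o (s + 1) i) (o (q + 1) i) +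
        dist (o (q + 1) i) (r q) + dist (r q) (r (q + 1)) + dist (r (q + 1)) (r e) := by
      have e1 := dist_triangle_left (r s) (r e) (o (s + 1) i)
      have e2 := dist_triangle4 (o (s + 1) i) (o (q + 1) i) (r q) (r e)
      have e3 := dist_triangle (r q) (r (q + 1)) (r e)
      linarith
    have h4 := hr q
    have h5 := hqP.2
    have h6 : ∑ u ∈ Finset.Ico s e, w u =
        ∑ u ∈ Finset.Ico s (q + 1), w u + ∑ u ∈ Finset.Ico (q + 1) e, w u :=
      (Finset.sum_Ico_consecutive _ (by have := hqP.1; omega) (by omega)).symm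
    have h7 : ((Finset.Ico (q + 1) e).filter fun u => ∀ i, y ≤ dist (o (u + 1) i) (r u)).card ≤
        ((Finset.Ico s e).filter fun u => ∀ i, y ≤ dist (o (u + 1) i) (r u)).card :=
      Finset.card_le_card (Finset.filter_subset_filter _
        (Finset.Ico_subset_Ico_left (by have := hqP.1; omega)))
    have h8 : mc * (((Finset.Ico (q + 1) e).filter
        fun u => ∀ i, y ≤ dist (o (u + 1) i) (r u)).card : ℝ) ≤
        mc * ((Finset.Ico s e).filter fun u => ∀ i, y ≤ dist (o (u + 1) i) (r u)).card :=
      mul_le_mul_of_nonneg_left (by exact_mod_cast h7) hmc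
    rw [Finset.card_erase_of_mem hiS,
      Nat.cast_sub (Nat.one_le_iff_ne_zero.2 (Finset.card_ne_zero_of_mem hiS))] at h1
    push_cast at h1
    linarith

end MobileServer

namespace MobileServer

/-! Lower bounds for the cost of schedules when the requests travel. -/

open Classical in
theorem uncovered_le_cost {d k : ℕ} (D : ℝ) (hk : 0 < k) (o : Schedule d k)
    (r : Requests d) (y : ℝ) (I : Finset ℕ) :
    y * (I.filter fun u => ∀ i, y ≤ dist (o (u + 1) i) (r u)).card + D * ∑ u ∈ I, moved o u ≤
      ∑ u ∈ I, stepCost D r o u := by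
  have h : y * (I.filter fun u => ∀ i, y ≤ dist (o (u + 1) i) (r u)).card ≤
      ∑ u ∈ I, service r o u := by
    rw [mul_comm, ← nsmul_eq_mul]
    refine (Finset.card_nsmul_le_sum _ _ _ fun u hu =>
      le_service r o u hk (Finset.mem_filter.1 hu).2).trans ?_
    exact Finset.sum_le_sum_of_subset_of_nonneg (Finset.filter_subset _ _)
      fun u _ _ => service_nonneg r o u
  simp only [stepCost, Finset.sum_add_distrib, ← Finset.mul_sum]
  linarith

section
variable {d k : ℕ} {D mc : ℝ} (hD : 1 < D) (hk : 0 < k) (hmc : 0 < mc) (r : Requests d)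
  (hr : ∀ t, dist (r t) (r (t + 1)) ≤ mc) (o : Schedule d k)
include hD hk hmc hr

/-- With closeness threshold `l / (8 * k)`, the jumps account for at most `5 / 16` of the
displacement `l`. The rest comes from server motion, at price `D` per unit length, and from
uncovered steps, each of which carries the request by at most `mc` and costs at least `2 * D * mc`.
-/
theorem mul_dist_request_le_cost {s e : ℕ} (hse : s ≤ e)
    (hl : 16 * k * D * mc ≤ dist (r s) (r e)) :
    D * dist (r s) (r e) / 2 ≤ ∑ u ∈ Finset.Ico s e, stepCost D r o u := by
  classical
  set l := dist (r s) (r e) with hldef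
  have hk' : (1 : ℝ) ≤ k := by exact_mod_cast hk
  have hkm : 0 < k * mc := by positivity
  have hl0 : 0 < l := lt_of_lt_of_le (by positivity) hl
  have hy : 0 ≤ l / (8 * k) := by positivity
  have h1 := dist_request_le (e := e) o r (moved o) hmc.le hy (dist_le_moved o) hr (moved_nonneg o)
    (e - s) Finset.univ s (by omega) fun _ _ _ i _ => Finset.mem_univ i
  have h2 := uncovered_le_cost D hk o r (l / (8 * k)) (Finset.Ico s e)
  set U : ℝ := (((Finset.Ico s e).filter
    fun u => ∀ i, l / (8 * k) ≤ dist (o (u + 1) i) (r u)).card : ℝ)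
  have hU : 0 ≤ U := Nat.cast_nonneg _
  set W := ∑ u ∈ Finset.Ico s e, moved o u
  rw [Finset.card_univ, Fintype.card_fin, ← hldef] at h1
  have e1 : (k : ℝ) * (2 * (l / (8 * k)) + mc) = l / 4 + k * mc := by field_simp; ring
  have e2 : k * mc ≤ l / 16 := by nlinarith
  have e3 : 2 * D * mc ≤ l / (8 * k) := by
    rw [le_div_iff₀ (by positivity)]; linarith
  have e4 : 2 * D * mc * U ≤ l / (8 * k) * U := mul_le_mul_of_nonneg_right e3 hU
  have e5 : l / 2 ≤ mc * U + W := by linarith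
  have e6 : D * (l / 2) ≤ D * (mc * U + W) := mul_le_mul_of_nonneg_left e5 (by linarith)
  have e7 : 0 ≤ D * mc * U := by positivity
  linarith

/-- Servers of speed at most `ms` pay when the requests travel at a higher average speed. -/
theorem mul_sq_dist_request_le_cost {ms δ : ℝ} (hms : 0 < ms) (hδ : 0 < δ) (hδ1 : δ < 1)
    (ho : SpeedAtMost ms o) {s e : ℕ} (hse : s ≤ e)
    (hT : (1 + δ / 8) * (ms * (e - s : ℕ)) ≤ dist (r s) (r e))
    (hl : 100 * (k * mc) ≤ δ * dist (r s) (r e)) :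
    δ ^ 2 * dist (r s) (r e) ^ 2 ≤ 2000 * k * mc * ∑ u ∈ Finset.Ico s e, stepCost D r o u := by
  classical
  set l := dist (r s) (r e) with hldef
  have hk' : (1 : ℝ) ≤ k := by exact_mod_cast hk
  have hkm : 0 < k * mc := by positivity
  have hl0 : 0 ≤ l := dist_nonneg
  have hy : 0 ≤ δ * l / (100 * k) := by positivity
  have h1 := dist_request_le (e := e) o r (fun _ => ms) hmc.le hy ho hr (fun _ => hms.le)
    (e - s) Finset.univ s (by omega) fun _ _ _ i _ => Finset.mem_univ i
  have h2 := uncovered_le_cost D hk o r (δ * l / (100 * k)) (Finset.Ico s e)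
  set U : ℝ := (((Finset.Ico s e).filter
    fun u => ∀ i, δ * l / (100 * k) ≤ dist (o (u + 1) i) (r u)).card : ℝ)
  have hW : 0 ≤ D * ∑ u ∈ Finset.Ico s e, moved o u :=
    mul_nonneg (by linarith) (Finset.sum_nonneg fun u _ => moved_nonneg o u)
  rw [Finset.card_univ, Fintype.card_fin, ← hldef, Finset.sum_const, Nat.card_Ico,
    nsmul_eq_mul] at h1
  set T : ℝ := ((e - s : ℕ) : ℝ)
  have hT0 : 0 ≤ ms * T := mul_nonneg hms.le (Nat.cast_nonneg _)
  -- The jumps account for at most `3 * δ * l / 100` and motion at speed `ms` for at most `l - δ * l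
  -- / 9`. Hence uncovered steps carry the request by at least `δ * l / 20`, each at service cost at
  -- least `δ * l / (100 * k)`.
  have e1 : (k : ℝ) * (2 * (δ * l / (100 * k)) + mc) = δ * l / 50 + k * mc := by
    field_simp; ring
  have e2 : ms * T ≤ l - δ * l / 9 := by nlinarith [mul_nonneg hδ.le hl0]
  have e3 : δ * l / 20 ≤ mc * U := by nlinarith
  have e4 : δ * l / (100 * k) * (δ * l / 20) ≤ δ * l / (100 * k) * (mc * U) :=
    mul_le_mul_of_nonneg_left e3 hy
  have e5 : δ ^ 2 * l ^ 2 = 2000 * k * (δ * l / (100 * k) * (δ * l / 20)) := by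
    field_simp; ring
  rw [e5, mul_assoc (2000 * (k : ℝ)) mc]
  refine mul_le_mul_of_nonneg_left ?_ (by positivity)
  calc _ ≤ _ := e4
    _ = mc * (δ * l / (100 * k) * U) := by ring
    _ ≤ _ := mul_le_mul_of_nonneg_left (by linarith) hmc.le

end

/-! The start, when the first request is far away. -/

section
variable {d k : ℕ} {D mc ms : ℝ} (hD : 1 < D) (hk : 0 < k) (hmc : 0 < mc) (r : Requests d)
  (hr : ∀ t, dist (r t) (r (t + 1)) ≤ mc) (o : Schedule d k)

theorem dist_request_zero_le (hr : ∀ t, dist (r t) (r (t + 1)) ≤ mc) (t : ℕ) :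
    dist (r 0) (r t) ≤ t * mc := by
  induction t with
  | zero => simp
  | succ t ih =>
    have := dist_triangle (r 0) (r t) (r (t + 1))
    have := hr t
    push_cast
    linarith

theorem dist_zero_le_of_speed {v : ℝ} (ho : SpeedAtMost v o) (i : Fin k) (t : ℕ) :
    dist (o 0 i) (o t i) ≤ t * v := by
  induction t with
  | zero => simp
  | succ t ih =>
    have := dist_triangle (o 0 i) (o t i) (o (t + 1) i)
    have := ho t i
    push_cast
    linarith

include hk hr in
theorem le_service_of_speed (hms : ms ≤ mc) (ho : SpeedAtMost ms o) {L : ℝ}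
    (hL : ∀ i, L ≤ dist (o 0 i) (r 0)) (t : ℕ) : L - (2 * t + 1) * mc ≤ service r o t := by
  refine le_service r o t hk fun i => ?_
  have h1 := dist_request_zero_le r hr t
  have h2 := dist_zero_le_of_speed o ho i (t + 1)
  have h3 := dist_triangle4 (o 0 i) (o (t + 1) i) (r t) (r 0)
  rw [dist_comm (r t)] at h3
  have h4 := hL i
  push_cast at h2
  have : ((t : ℝ) + 1) * ms ≤ (t + 1) * mc := mul_le_mul_of_nonneg_left hms (by positivity)
  linarith

-- In each of the first `⌈L / (4 * mc)⌉` steps, request and servers together have covered at most `3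
-- * L / 4`, so the service cost is still at least `L / 4`.
include hD hk hmc hr in
theorem sq_le_cost_of_speed (hms : ms ≤ mc) (ho : SpeedAtMost ms o) {L : ℝ}
    (hL : ∀ i, L ≤ dist (o 0 i) (r 0)) (hLm : 4 * mc ≤ L) {n : ℕ} (hn : L ≤ n * (4 * mc)) :
    L ^ 2 ≤ 16 * mc * cost D r o n := by
  set T := ⌈L / (4 * mc)⌉₊ with hT
  have hTn : T ≤ n := Nat.ceil_le.2 ((div_le_iff₀ (by positivity)).2 hn)
  have hTL : L ≤ T * (4 * mc) := (div_le_iff₀ (by positivity)).1 (Nat.le_ceil _)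
  have h1 : ∀ t ∈ Finset.range T, L / 4 ≤ stepCost D r o t := fun t ht => by
    have h := Nat.lt_ceil.1 (Finset.mem_range.1 ht)
    rw [lt_div_iff₀ (by positivity)] at h
    have := le_service_of_speed hk r hr o hms ho hL t
    have := service_le_stepCost r o t hD
    linarith
  have h2 := Finset.card_nsmul_le_sum _ _ _ h1
  rw [Finset.card_range, nsmul_eq_mul] at h2
  have h3 : ∑ t ∈ Finset.range T, stepCost D r o t ≤ cost D r o n :=
    Finset.sum_le_sum_of_subset_of_nonneg (Finset.range_subset_range.2 hTn)
      fun t _ _ => stepCost_nonneg r o t hD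
  nlinarith

-- Without a speed limit there is an alternative: within the first `⌈L / (4 * mc)⌉` steps the
-- servers move by `L / 4` in total, or each of these steps has service cost at least `L / 2`.
include hD hk hmc hr in
theorem mul_le_cost_of_far_start {L : ℝ} (hL : ∀ i, L ≤ dist (o 0 i) (r 0))
    (hLm : 16 * k * D * mc ≤ L) {n : ℕ} (hn : L ≤ n * (4 * mc)) :
    D * L / 4 ≤ cost D r o n := by
  have hk' : (1 : ℝ) ≤ k := by exact_mod_cast hk
  have hDm : D * mc ≤ k * (D * mc) := le_mul_of_one_le_left (by positivity) hk'
  have hL0 : 0 < L := lt_of_lt_of_le (by positivity) hLm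
  set T := ⌈L / (4 * mc)⌉₊ with hT
  have hTn : T ≤ n := Nat.ceil_le.2 ((div_le_iff₀ (by positivity)).2 hn)
  have hTL : L ≤ T * (4 * mc) := (div_le_iff₀ (by positivity)).1 (Nat.le_ceil _)
  have h3 : ∑ t ∈ Finset.range T, stepCost D r o t ≤ cost D r o n :=
    Finset.sum_le_sum_of_subset_of_nonneg (Finset.range_subset_range.2 hTn)
      fun t _ _ => stepCost_nonneg r o t hD
  refine le_trans ?_ h3
  by_cases hm : L / 4 ≤ ∑ t ∈ Finset.range T, moved o t
  · calc D * L / 4 ≤ D * ∑ t ∈ Finset.range T, moved o t := by nlinarith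
      _ ≤ _ := by
        rw [Finset.mul_sum]
        exact Finset.sum_le_sum fun t _ => mul_moved_le_stepCost r o t D
  · push Not at hm
    have h1 : ∀ t ∈ Finset.range T, L / 2 ≤ stepCost D r o t := fun t ht => by
      have h := Nat.lt_ceil.1 (Finset.mem_range.1 ht)
      rw [lt_div_iff₀ (by positivity)] at h
      refine le_trans (le_service r o t hk fun i => ?_) (service_le_stepCost r o t hD)
      have h4 := dist_le_sum_moves o (moved o) (dist_le_moved o) i (Nat.zero_le (t + 1))
      have h5 : ∑ u ∈ Finset.Ico 0 (t + 1), moved o u ≤ ∑ t ∈ Finset.range T, moved o t := by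
        rw [← Finset.range_eq_Ico]
        exact Finset.sum_le_sum_of_subset_of_nonneg
          (Finset.range_subset_range.2 (Finset.mem_range.1 ht)) fun u _ _ => moved_nonneg o u
      have h6 := dist_request_zero_le r hr t
      have h7 := dist_triangle4 (o 0 i) (o (t + 1) i) (r t) (r 0)
      rw [dist_comm (r t)] at h7
      have := hL i
      linarith
    have h2 := Finset.card_nsmul_le_sum _ _ _ h1
    rw [Finset.card_range, nsmul_eq_mul] at h2
    refine le_trans ?_ h2
    nlinarith

end

end MobileServer

namespace MobileServer

/-! The projected pages. -/

section
variable {d k : ℕ} {ρ mc : ℝ} (r : Requests d) (c : Schedule d k)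

theorem phaseStart_eq_of_startsPhase {t : ℕ} (h : StartsPhase ρ r t) :
    phaseStart ρ r t = r t := by
  cases t with
  | zero => rfl
  | succ t => exact if_pos h

theorem dist_phaseStart_le (hρ : 0 ≤ ρ) (t : ℕ) : dist (phaseStart ρ r t) (r t) ≤ ρ := by
  by_cases h : StartsPhase ρ r t
  · rw [phaseStart_eq_of_startsPhase r h, dist_self]
    exact hρ
  · cases t with
    | zero => exact absurd trivial h
    | succ t =>
      have h' : ¬ ρ ≤ dist (phaseStart ρ r t) (r (t + 1)) := h
      rw [phaseStart, if_neg h']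
      exact (not_le.1 h').le

theorem phaseStart_succ_of_not {t : ℕ} (h : ¬ StartsPhase ρ r (t + 1)) :
    phaseStart ρ r (t + 1) = phaseStart ρ r t := if_neg h

theorem dist_moveToward_center_le {x y : Pt d} (hρ : 0 ≤ ρ) : dist (moveToward x y ρ) x ≤ ρ := by
  rw [dist_comm, dist_self_moveToward x y hρ]
  exact min_le_left _ _

open Classical in
theorem projSchedule_succ (t : ℕ) (i : Fin k) :
    projSchedule ρ r c (t + 1) i = if dist (c (t + 1) i) (r t) ≤ ρ then c (t + 1) i
      else if StartsPhase ρ r t then moveToward (r t) (c (t + 1) i) ρ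
      else projSchedule ρ r c t i := rfl

/-- A copied page is within `ρ` of the request, which is within `ρ` of the phase start; a page that
stays keeps its bound because the phase start does not change. -/
theorem dist_projSchedule_phaseStart_le (hρ : 0 ≤ ρ) (t : ℕ) (i : Fin k) :
    dist (projSchedule ρ r c (t + 1) i) (phaseStart ρ r t) ≤ 2 * ρ := by
  have hp := dist_phaseStart_le r hρ
  induction t with
  | zero =>
    have h2 : StartsPhase ρ r 0 := trivial
    rw [projSchedule_succ, if_pos h2, phaseStart_eq_of_startsPhase r h2]
    split_ifs with h1
    · exact h1.trans (by linarith)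
    · exact (dist_moveToward_center_le hρ).trans (by linarith)
  | succ t ih =>
    rw [projSchedule_succ]
    split_ifs with h1 h2
    · have := dist_triangle_right (c (t + 1 + 1) i) (phaseStart ρ r (t + 1)) (r (t + 1))
      have := hp (t + 1)
      linarith
    · rw [phaseStart_eq_of_startsPhase r h2]
      exact (dist_moveToward_center_le hρ).trans (by linarith)
    · rw [phaseStart_succ_of_not r h2]
      exact ih

theorem dist_projSchedule_request_le (hρ : 0 ≤ ρ) (t : ℕ) (i : Fin k) :
    dist (projSchedule ρ r c (t + 1) i) (r t) ≤ 3 * ρ := by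
  have h1 := dist_projSchedule_phaseStart_le r c hρ t i
  have h2 := dist_phaseStart_le r hρ t
  have h3 := dist_triangle (projSchedule ρ r c (t + 1) i) (phaseStart ρ r t) (r t)
  linarith

-- The truncated distance between a page and its projection is a potential. When a page is copied,
-- its projection moves by at most `5 * ρ`, so the cap `6 * ρ` suffices to pay. When a phase starts,
-- the move and the new potential together fit into `12 * ρ`. The last term covers the first step,
-- where the old position need not be near the request.
open Classical in
theorem dist_projSchedule_succ_le (hρ : 0 ≤ ρ) (hmc : mc ≤ ρ)
    (hr : ∀ t, dist (r t) (r (t + 1)) ≤ mc) (t : ℕ) (i : Fin k) :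
    dist (projSchedule ρ r c t i) (projSchedule ρ r c (t + 1) i) +
        min (dist (projSchedule ρ r c (t + 1) i) (c (t + 1) i)) (6 * ρ) ≤
      min (dist (projSchedule ρ r c t i) (c t i)) (6 * ρ) + dist (c t i) (c (t + 1) i) +
        ((if StartsPhase ρ r t then 12 * ρ else 0) + if t = 0 then dist (c 0 i) (r 0) else 0) := by
  set p := projSchedule ρ r c with hp
  have hmin : min (dist (p (t + 1) i) (c (t + 1) i)) (6 * ρ) ≤ 6 * ρ := min_le_right _ _
  have hnear := dist_projSchedule_request_le r c hρ t i
  rw [← hp] at hnear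
  cases t with
  | zero =>
    have h0 : p 0 i = c 0 i := rfl
    have hs : StartsPhase ρ r 0 := trivial
    have h1 := dist_triangle_right (p 0 i) (p (0 + 1) i) (r 0)
    have h2 := dist_nonneg (x := c 0 i) (y := c (0 + 1) i)
    have h3 : 0 ≤ min (dist (p 0 i) (c 0 i)) (6 * ρ) := le_min dist_nonneg (by linarith)
    rw [h0] at h1 h3 ⊢
    rw [if_pos hs, if_pos rfl]
    linarith
  | succ t =>
    have hold := dist_projSchedule_request_le r c hρ t i
    rw [← hp] at hold
    have hrt := hr t
    have hdist := dist_nonneg (x := c (t + 1) i) (y := c (t + 1 + 1) i)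
    have h3 : 0 ≤ min (dist (p (t + 1) i) (c (t + 1) i)) (6 * ρ) :=
      le_min dist_nonneg (by linarith)
    have hold' : dist (p (t + 1) i) (r (t + 1)) ≤ 4 * ρ := by
      have := dist_triangle (p (t + 1) i) (r t) (r (t + 1))
      linarith
    have hnz : ¬ t + 1 = 0 := by omega
    rw [if_neg hnz]
    have hstep := projSchedule_succ (ρ := ρ) r c (t + 1) i
    rw [← hp] at hstep
    by_cases hc : dist (c (t + 1 + 1) i) (r (t + 1)) ≤ ρ
    · rw [if_pos hc] at hstep
      have h0 : 0 ≤ if StartsPhase ρ r (t + 1) then 12 * ρ else 0 := by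
        split_ifs <;> linarith
      rw [hstep, dist_self, min_eq_left (by linarith)]
      have h5 := dist_triangle (p (t + 1) i) (c (t + 1) i) (c (t + 1 + 1) i)
      have h6 := dist_triangle_right (p (t + 1) i) (c (t + 1 + 1) i) (r (t + 1))
      rcases min_cases (dist (p (t + 1) i) (c (t + 1) i)) (6 * ρ) with ⟨h, _⟩ | ⟨h, _⟩ <;>
        rw [h] <;> linarith
    · rw [if_neg hc] at hstep
      by_cases hs : StartsPhase ρ r (t + 1)
      · rw [if_pos hs]
        have h6 := dist_triangle_right (p (t + 1) i) (p (t + 1 + 1) i) (r (t + 1))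
        rw [if_pos hs] at hstep
        have h7 : dist (p (t + 1 + 1) i) (r (t + 1)) ≤ ρ := by
          rw [hstep]; exact dist_moveToward_center_le hρ
        linarith
      · rw [if_neg hs] at hstep
        rw [if_neg hs, hstep, dist_self]
        have h5 := dist_triangle (p (t + 1) i) (c (t + 1) i) (c (t + 1 + 1) i)
        rcases min_cases (dist (p (t + 1) i) (c (t + 1) i)) (6 * ρ) with ⟨h, _⟩ | ⟨h, _⟩
        · rw [h]
          linarith [min_le_left (dist (p (t + 1) i) (c (t + 1 + 1) i)) (6 * ρ)]
        · rw [h]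
          linarith [min_le_right (dist (p (t + 1) i) (c (t + 1 + 1) i)) (6 * ρ)]

open Classical in
/-- The number of phases that start in the first `n` steps. -/
noncomputable def phaseCount (ρ : ℝ) (r : Requests d) (n : ℕ) : ℕ :=
  ((Finset.range n).filter (StartsPhase ρ r)).card

theorem sum_moved_projSchedule_le (hρ : 0 ≤ ρ) (hmc : mc ≤ ρ)
    (hr : ∀ t, dist (r t) (r (t + 1)) ≤ mc) (n : ℕ) :
    ∑ t ∈ Finset.range n, moved (projSchedule ρ r c) t ≤
      ∑ t ∈ Finset.range n, moved c t + 12 * ρ * k * phaseCount ρ r n +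
        ∑ i, dist (c 0 i) (r 0) := by
  classical
  have key : ∀ i, ∀ n : ℕ,
      ∑ t ∈ Finset.range n, dist (projSchedule ρ r c t i) (projSchedule ρ r c (t + 1) i) +
        min (dist (projSchedule ρ r c n i) (c n i)) (6 * ρ) ≤
      ∑ t ∈ Finset.range n, (dist (c t i) (c (t + 1) i) +
        (if StartsPhase ρ r t then 12 * ρ else 0) + if t = 0 then dist (c 0 i) (r 0) else 0) := by
    intro i n
    induction n with
    | zero =>
      have : projSchedule ρ r c 0 i = c 0 i := rfl
      simp only [Finset.range_zero, Finset.sum_empty, this, dist_self]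
      rw [min_eq_left (by linarith)]
      simp
    | succ n ih =>
      rw [Finset.sum_range_succ, Finset.sum_range_succ _ n]
      have := dist_projSchedule_succ_le r c hρ hmc hr n i
      linarith
  have h1 : ∀ i, ∑ t ∈ Finset.range n,
      dist (projSchedule ρ r c t i) (projSchedule ρ r c (t + 1) i) ≤
      ∑ t ∈ Finset.range n, dist (c t i) (c (t + 1) i) + 12 * ρ * phaseCount ρ r n +
        dist (c 0 i) (r 0) := by
    intro i
    have h2 := key i n
    have h3 : 0 ≤ min (dist (projSchedule ρ r c n i) (c n i)) (6 * ρ) :=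
      le_min dist_nonneg (by linarith)
    rw [Finset.sum_add_distrib, Finset.sum_add_distrib, Finset.sum_ite, Finset.sum_const_zero,
      Finset.sum_const, nsmul_eq_mul, Finset.sum_ite_eq'] at h2
    have h4 : (if 0 ∈ Finset.range n then dist (c 0 i) (r 0) else 0) ≤ dist (c 0 i) (r 0) := by
      split_ifs
      exacts [le_rfl, dist_nonneg]
    unfold phaseCount
    linarith
  have h2 := Finset.sum_le_sum fun i (_ : i ∈ Finset.univ) => h1 i
  rw [Finset.sum_add_distrib, Finset.sum_add_distrib, Finset.sum_const, Finset.card_univ,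
    Fintype.card_fin, nsmul_eq_mul, Finset.sum_comm, Finset.sum_comm (s := Finset.univ)] at h2
  unfold moved
  linarith

/-- Consecutive phase starts are at distance at least `ρ`, so each completed phase costs the
schedule `D * ρ / 2`, over disjoint time intervals. -/
theorem phaseCount_le {D : ℝ} (hD : 1 < D) (hk : 0 < k) (hmc : 0 < mc)
    (hr : ∀ t, dist (r t) (r (t + 1)) ≤ mc) (n : ℕ) :
    D * (16 * k * D * mc) / 2 * phaseCount (16 * k * D * mc) r n ≤
      cost D r c n + D * (16 * k * D * mc) / 2 := by
  classical
  set ρ := 16 * k * D * mc with hρ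
  have hρ0 : 0 ≤ ρ := by positivity
  have hDρ : 0 ≤ D * ρ / 2 := by positivity
  -- `s` is an index at which the current phase started. Only costs before `s` are charged, which
  -- leaves the interval from `s` for the next phase.
  have key : ∀ t, ∃ s ≤ t, r s = phaseStart ρ r t ∧
      D * ρ / 2 * phaseCount ρ r (t + 1) ≤
        ∑ u ∈ Finset.range s, stepCost D r c u + D * ρ / 2 := by
    intro t
    induction t with
    | zero =>
      refine ⟨0, le_rfl, rfl, ?_⟩
      have : phaseCount ρ r (0 + 1) ≤ 1 := by
        unfold phaseCount
        exact (Finset.card_filter_le _ _).trans_eq (by simp)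
      have : (phaseCount ρ r (0 + 1) : ℝ) ≤ 1 := by exact_mod_cast this
      simp only [Finset.range_zero, Finset.sum_empty, zero_add]
      nlinarith
    | succ t ih =>
      obtain ⟨s, hst, hs, h⟩ := ih
      have hcount : phaseCount ρ r (t + 1 + 1) =
          phaseCount ρ r (t + 1) + if StartsPhase ρ r (t + 1) then 1 else 0 := by
        unfold phaseCount
        rw [Finset.range_add_one, Finset.filter_insert]
        split_ifs
        · rw [Finset.card_insert_of_notMem (by simp)]
        · rfl
      by_cases hp : StartsPhase ρ r (t + 1)
      · refine ⟨t + 1, le_rfl, (phaseStart_eq_of_startsPhase r hp).symm, ?_⟩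
        have hd : ρ ≤ dist (r s) (r (t + 1)) := by rw [hs]; exact hp
        have h1 := mul_dist_request_le_cost hD hk hmc r hr c (by omega : s ≤ t + 1) hd
        have h2 := Finset.sum_range_add_sum_Ico (fun u => stepCost D r c u)
          (by omega : s ≤ t + 1)
        rw [hcount, if_pos hp]
        push_cast
        nlinarith
      · refine ⟨s, by omega, hs.trans (phaseStart_succ_of_not r hp).symm, ?_⟩
        rw [hcount, if_neg hp]
        simpa using h
  cases n with
  | zero =>
    have h0 := cost_nonneg r c hD 0
    simp only [phaseCount, Finset.range_zero, Finset.filter_empty, Finset.card_empty,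
      Nat.cast_zero, mul_zero]
    linarith
  | succ t =>
    obtain ⟨s, hst, _, h⟩ := key t
    have : ∑ u ∈ Finset.range s, stepCost D r c u ≤ cost D r c (t + 1) :=
      Finset.sum_le_sum_of_subset_of_nonneg (Finset.range_subset_range.2 (by omega))
        fun u _ _ => stepCost_nonneg r c u hD
    linarith

/-- Either the closest page is copied, or the service cost of `c` exceeds `ρ` while projected pages
are within `3 * ρ`. -/
theorem service_projSchedule_le (hk : 0 < k) (hρ : 0 ≤ ρ) (t : ℕ) :
    service r (projSchedule ρ r c) t ≤ 3 * service r c t := by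
  obtain ⟨i, hi⟩ := exists_service_eq r c t hk
  have h0 := service_nonneg r c t
  have h1 := service_le r (projSchedule ρ r c) t i
  by_cases h : dist (c (t + 1) i) (r t) ≤ ρ
  · rw [projSchedule_succ, if_pos h] at h1
    linarith
  · have := dist_projSchedule_request_le r c hρ t i
    linarith

end

end MobileServer

namespace MobileServer

/-! One step of WMS. -/

section
variable {d k : ℕ} {D ms δ : ℝ} (T : TieBreaking d k) (π : Equiv.Perm (Fin k)) (j : Fin k)
  (a c : Config d k) (x : Pt d)

theorem greedyMove_self : greedyMove D ms δ π j a c x j =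
    moveToward (a j) x (min ((1 + δ / 2) * ms) (1 / D * (1 - δ / 2) * dist (a j) x)) :=
  if_pos rfl

theorem greedyMove_of_ne {i : Fin k} (h : i ≠ j) : greedyMove D ms δ π j a c x i =
    moveToward (a i) (c (π i)) (min ((1 + δ) * ms) (1 / D * dist (a j) x)) :=
  if_neg h

variable (hD : 1 < D) (hms : 0 < ms) (hδ : 0 < δ) (hδ1 : δ < 1)

open Classical in
theorem wmsStep_eq_or : wmsStep D ms δ T a c x = greedyMove D ms δ (T.matching a c)
      (T.closest a x) a c x ∧ (∀ i, dist (greedyMove D ms δ (T.matching a c)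
        (T.closest a x) a c x (T.closest a x)) x ≤
        dist (greedyMove D ms δ (T.matching a c) (T.closest a x) a c x i) x) ∨
    wmsStep D ms δ T a c x = (fun i => moveToward (a i) (c (T.matching a c i)) ((1 + δ) * ms)) ∧
      ∃ i, i ≠ T.closest a x ∧
        dist (greedyMove D ms δ (T.matching a c) (T.closest a x) a c x i) x <
          dist (greedyMove D ms δ (T.matching a c) (T.closest a x) a c x (T.closest a x)) x := by
  by_cases h : ∃ i, i ≠ T.closest a x ∧
        dist (greedyMove D ms δ (T.matching a c) (T.closest a x) a c x i) x <
          dist (greedyMove D ms δ (T.matching a c) (T.closest a x) a c x (T.closest a x)) x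
  · exact Or.inr ⟨if_pos h, h⟩
  · refine Or.inl ⟨if_neg h, fun i => ?_⟩
    push Not at h
    by_cases hi : i = T.closest a x
    · rw [hi]
    · exact h i hi

section
set_option linter.unusedSectionVars false
include hD hms hδ hδ1

theorem greedy_speed_nonneg (X : ℝ) (hX : 0 ≤ X) :
    0 ≤ min ((1 + δ / 2) * ms) (1 / D * (1 - δ / 2) * X) := by
  have : 0 ≤ 1 - δ / 2 := by linarith
  positivity

theorem follow_speed_nonneg (X : ℝ) (hX : 0 ≤ X) :
    0 ≤ min ((1 + δ) * ms) (1 / D * X) := by positivity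

theorem greedy_speed_le_self (X : ℝ) (hX : 0 ≤ X) :
    min ((1 + δ / 2) * ms) (1 / D * (1 - δ / 2) * X) ≤ (1 - δ / 2) * X := by
  refine (min_le_right _ _).trans ?_
  have h1 : 1 / D ≤ 1 := by rw [div_le_one (by linarith)]; exact hD.le
  have h2 : 0 ≤ (1 - δ / 2) * X := mul_nonneg (by linarith) hX
  nlinarith

theorem mul_greedy_speed_le (X : ℝ) (hX : 0 ≤ X) :
    D * min ((1 + δ / 2) * ms) (1 / D * (1 - δ / 2) * X) ≤ X := by
  have h : D * min ((1 + δ / 2) * ms) (1 / D * (1 - δ / 2) * X) ≤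
      D * (1 / D * (1 - δ / 2) * X) := mul_le_mul_of_nonneg_left (min_le_right _ _) (by linarith)
  have h2 : D * (1 / D * (1 - δ / 2) * X) = (1 - δ / 2) * X := by field_simp
  nlinarith

theorem greedy_speed_le_follow_speed (X : ℝ) (hX : 0 ≤ X) :
    min ((1 + δ / 2) * ms) (1 / D * (1 - δ / 2) * X) ≤
      (1 - δ / 4) * min ((1 + δ) * ms) (1 / D * X) := by
  have h0 : 0 ≤ 1 / D * X := by positivity
  rw [mul_min_of_nonneg _ _ (by linarith)]
  refine le_min ((min_le_left _ _).trans ?_) ((min_le_right _ _).trans ?_)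
  · have : (1 + δ / 2) ≤ (1 - δ / 4) * (1 + δ) := by nlinarith
    nlinarith
  · nlinarith

theorem half_min_le_greedy_speed (X : ℝ) (hX : 0 ≤ X) :
    min ms (1 / D * X) / 2 ≤ min ((1 + δ / 2) * ms) (1 / D * (1 - δ / 2) * X) := by
  have h0 : 0 ≤ 1 / D * X := by positivity
  have h1 := min_le_left ms (1 / D * X)
  have h2 := min_le_right ms (1 / D * X)
  refine le_min ?_ ?_ <;> nlinarith

theorem min_le_follow_speed (X : ℝ) :
    min ms (1 / D * X) ≤ min ((1 + δ) * ms) (1 / D * X) :=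
  min_le_min_right _ (by nlinarith)

end

include hD hms hδ hδ1 in
theorem dist_wmsStep_le (i : Fin k) : dist (a i) (wmsStep D ms δ T a c x i) ≤ (1 + δ) * ms := by
  have hX := dist_nonneg (x := a (T.closest a x)) (y := x)
  rcases wmsStep_eq_or (D := D) (ms := ms) (δ := δ) T a c x with ⟨h, _⟩ | ⟨h, _⟩
  · rw [h]
    by_cases hi : i = T.closest a x
    · rw [hi, greedyMove_self, dist_self_moveToward _ _
        (greedy_speed_nonneg hD hms hδ hδ1 _ hX)]
      exact (min_le_left _ _).trans ((min_le_left _ _).trans (by nlinarith))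
    · rw [greedyMove_of_ne _ _ _ _ _ hi, dist_self_moveToward _ _
        (follow_speed_nonneg hD hms hδ hδ1 _ hX)]
      exact (min_le_left _ _).trans (min_le_left _ _)
  · rw [h, dist_self_moveToward _ _ (by positivity)]
    exact min_le_left _ _

/-- The total weight of the matching of WMS. -/
noncomputable def matchWeight (T : TieBreaking d k) (a c : Config d k) : ℝ :=
  ∑ i, dist (a i) (c (T.matching a c i))

end

/-! ### Inequalities for the amortization of one tentative move. -/

section
variable {D δ Y Λ F S μ σ σ₀ Δ X s E b : ℝ} (hD : 1 < D) (hδ : 0 < δ) (hΛ : 1 ≤ Λ)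
  (hYD : 0 ≤ Y * D) (hS0 : 0 ≤ S)

include hD hΛ hYD hS0

/-- Here `μ` is the move of the selected server, `S` the total move of the others, `Δ` the fall of
the matching weight. A follower moving the full `σ` gives `Δ ≥ δ / 4 * S`, which `Y = 12 * Λ / δ`
turns into `3 * Λ * D * S`. -/
theorem amortized_of_partner_far (hδ : 0 < δ) (hδ1 : δ < 1) (hY : Y * δ = 12 * Λ)
    (hΔ : S - μ ≤ Δ) (hμσ : μ ≤ (1 - δ / 4) * σ) (hσS : σ ≤ S) (hσ : σ₀ ≤ σ)
    (hX : X ≤ Λ * D * σ₀ + F) (hE : 0 ≤ E) :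
    D * (μ + S) + X ≤ Y * D * Δ + E + F := by
  have hμS : μ ≤ (1 - δ / 4) * S :=
     hμσ.trans (mul_le_mul_of_nonneg_left hσS (by linarith))
  have h1 : Y * D * (δ / 4 * S) ≤ Y * D * Δ := mul_le_mul_of_nonneg_left (by linarith) hYD
  have h2 : Y * D * (δ / 4 * S) = 3 * (Λ * (D * S)) := by linear_combination D * S / 4 * hY
  have hDS : 0 ≤ D * S := mul_nonneg (by linarith) hS0
  have h3 : D * S ≤ Λ * (D * S) := le_mul_of_one_le_left hDS hΛ
  have h4 : Λ * D * σ₀ ≤ Λ * (D * S) := by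
    rw [mul_assoc]
    exact mul_le_mul_of_nonneg_left (mul_le_mul_of_nonneg_left (hσ.trans hσS) (by linarith))
      (by linarith)
  have h5 : D * μ ≤ D * S := mul_le_mul_of_nonneg_left (by nlinarith) (by linarith)
  linarith

theorem amortized_of_drop (hY : 12 * Λ ≤ Y) (hμ0 : 0 ≤ μ) (hΔ : (S + μ) / 2 ≤ Δ)
    (hσ : σ₀ / 2 ≤ μ) (hX : X ≤ Λ * D * σ₀ + F) (hE : 0 ≤ E) :
    D * (μ + S) + X ≤ Y * D * Δ + E + F := by
  have h1 : Y * D * ((S + μ) / 2) ≤ Y * D * Δ := mul_le_mul_of_nonneg_left hΔ hYD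
  have hDn : 0 ≤ D * (S + μ) := mul_nonneg (by linarith) (by linarith)
  have h2 : 12 * Λ * (D * (S + μ)) ≤ Y * (D * (S + μ)) := mul_le_mul_of_nonneg_right hY hDn
  have h3 : D * (S + μ) ≤ Λ * (D * (S + μ)) := le_mul_of_one_le_left hDn hΛ
  have h4 : Λ * (D * (σ₀ / 2)) ≤ Λ * (D * (S + μ)) :=
    mul_le_mul_of_nonneg_left (mul_le_mul_of_nonneg_left (by linarith) (by linarith))
      (by linarith)
  linarith

/-- The weight may rise by up to `μ` here; since `D * μ ≤ X`, both this rise and `X` are charged to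
the simulated service cost `s`. -/
theorem amortized_of_service_large (hδ : 0 < δ) (hY : 12 * Λ ≤ Y) (hs0 : 0 ≤ s) (hF : 0 ≤ F)
    (hΔ : S - μ ≤ Δ) (hDμ : D * μ ≤ X) (hX : X ≤ b / δ * s) (hb : b ≤ 4) :
    D * (μ + S) + X ≤ Y * D * Δ + 12 * Y / δ * s + F := by
  have hX0 : X ≤ 4 / δ * s := hX.trans (by gcongr)
  have hs4 : 0 ≤ 4 / δ * s := by positivity
  have h1 : Y * D * (S - μ) ≤ Y * D * Δ := mul_le_mul_of_nonneg_left hΔ hYD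
  have h2 : D * S ≤ Y * D * S := by
    rw [mul_assoc]
    exact le_mul_of_one_le_left (mul_nonneg (by linarith) hS0) (by linarith)
  have h3 : Y * (D * μ) ≤ Y * (4 / δ * s) :=
    mul_le_mul_of_nonneg_left (hDμ.trans hX0) (by linarith)
  have h4 : 4 / δ * s ≤ Y * (4 / δ * s) := le_mul_of_one_le_left hs4 (by linarith)
  have h5 : 12 * Y / δ * s = 3 * (Y * (4 / δ * s)) := by ring
  linarith

end

section
variable {d k : ℕ} {D ms δ Y Λ F : ℝ} (T : TieBreaking d k) (π : Equiv.Perm (Fin k)) (j : Fin k)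
  (a c : Config d k) (x : Pt d)
  (hD : 1 < D) (hms : 0 < ms) (hδ : 0 < δ) (hδ1 : δ < 1)
  (hΛ : 1 ≤ Λ) (hY : Y * δ = 12 * Λ) (hF : 0 ≤ F)
include hD hms hδ hδ1 hΛ hY hF

set_option maxHeartbeats 400000 in
theorem greedy_step_le
    (hX : dist (a j) x ≤ Λ * D * min ms (1 / D * dist (a j) x) + F)
    (hj : ∀ i, dist (greedyMove D ms δ π j a c x j) x ≤ dist (greedyMove D ms δ π j a c x i) x)
    (q : Fin k) :
    D * ∑ i, dist (a i) (greedyMove D ms δ π j a c x i) +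
        dist (greedyMove D ms δ π j a c x j) x +
        Y * D * ∑ i, dist (greedyMove D ms δ π j a c x i) (c (π i)) ≤
      Y * D * ∑ i, dist (a i) (c (π i)) + 12 * Y / δ * dist (c q) x + F := by
  set g := greedyMove D ms δ π j a c x with hg
  set X := dist (a j) x with hXdef
  have hX0 : 0 ≤ X := dist_nonneg
  set σ := min ((1 + δ) * ms) (1 / D * X) with hσ
  set μ := min ((1 + δ / 2) * ms) (1 / D * (1 - δ / 2) * X) with hμ
  set σ₀ := min ms (1 / D * X) with hσ₀
  have hσ0 : 0 ≤ σ := follow_speed_nonneg hD hms hδ hδ1 X hX0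
  have hμ0 : 0 ≤ μ := greedy_speed_nonneg hD hms hδ hδ1 X hX0
  have hσ₀σ : σ₀ ≤ σ := min_le_follow_speed hD hms hδ hδ1 X
  have hσ₀μ : σ₀ / 2 ≤ μ := half_min_le_greedy_speed hD hms hδ hδ1 X hX0
  have hμσ : μ ≤ (1 - δ / 4) * σ := greedy_speed_le_follow_speed hD hms hδ hδ1 X hX0
  have hμX : μ ≤ (1 - δ / 2) * X := greedy_speed_le_self hD hms hδ hδ1 X hX0
  have hDμ : D * μ ≤ X := mul_greedy_speed_le hD hms hδ hδ1 X hX0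
  have hμX' : min μ X = μ := min_eq_left (by nlinarith)
  have hgj : g j = moveToward (a j) x μ := greedyMove_self π j a c x
  have hmj : dist (a j) (g j) = μ := by rw [hgj, dist_self_moveToward _ _ hμ0, ← hXdef, hμX']
  have hgx : dist (g j) x = X - μ := by
    rw [hgj, dist_moveToward_target _ _ hμ0, ← hXdef, hμX']
  have hgi : ∀ i ∈ Finset.univ.erase j, g i = moveToward (a i) (c (π i)) σ := fun i hi =>
    greedyMove_of_ne π j a c x (Finset.ne_of_mem_erase hi)
  set S := ∑ i ∈ Finset.univ.erase j, min σ (dist (a i) (c (π i))) with hS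
  have hmin0 : ∀ i, 0 ≤ min σ (dist (a i) (c (π i))) := fun i => le_min hσ0 dist_nonneg
  have hS0 : 0 ≤ S := Finset.sum_nonneg fun i _ => hmin0 i
  have hmove : ∑ i, dist (a i) (g i) = μ + S := by
    rw [← Finset.add_sum_erase _ _ (Finset.mem_univ j), hmj]
    congr 1
    exact Finset.sum_congr rfl fun i hi => by rw [hgi i hi, dist_self_moveToward _ _ hσ0]
  have hw : ∑ i, dist (g i) (c (π i)) = dist (g j) (c (π j)) +
      (∑ i, dist (a i) (c (π i)) - dist (a j) (c (π j)) - S) := by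
    rw [← Finset.add_sum_erase _ _ (Finset.mem_univ j),
      ← Finset.add_sum_erase _ (fun i => dist (a i) (c (π i))) (Finset.mem_univ j),
      add_sub_cancel_left, hS, ← Finset.sum_sub_distrib]
    congr 1
    exact Finset.sum_congr rfl fun i hi => by rw [hgi i hi, dist_moveToward_target _ _ hσ0]
  have hdj : dist (g j) (c (π j)) ≤ dist (a j) (c (π j)) + μ := by
    have := dist_triangle_left (g j) (c (π j)) (a j)
    linarith
  have hs0 : 0 ≤ dist (c q) x := dist_nonneg
  rw [hmove, hw, hgx]
  set W := ∑ i, dist (a i) (c (π i))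
  set u := dist (a j) (c (π j))
  set u' := dist (g j) (c (π j))
  set s := dist (c q) x
  have hY12 : 12 * Λ ≤ Y := by
    have : 0 < Y := by
      by_contra h
      nlinarith
    nlinarith
  have hYD : 0 ≤ Y * D := mul_nonneg (by linarith) (by linarith)
  have hYs : 0 ≤ 12 * Y / δ * s := by
    have : 0 ≤ Y := by linarith
    positivity
  suffices h : D * (μ + S) + X ≤ Y * D * (S + u - u') + 12 * Y / δ * s + F by linarith
  have hdrop0 : S - μ ≤ S + u - u' := by linarith
  -- Otherwise all followers reach their partners, and the case depends on which server is matched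
  -- to the page `q`.
  by_cases hfar : ∃ i ∈ Finset.univ.erase j, σ ≤ dist (a i) (c (π i))
  · obtain ⟨i, hi, hi'⟩ := hfar
    have hσS : σ ≤ S := by
      have := Finset.single_le_sum (f := fun i => min σ (dist (a i) (c (π i))))
        (fun i _ => hmin0 i) hi
      rwa [min_eq_left hi'] at this
    exact amortized_of_partner_far hD hΛ hYD hS0 hδ hδ1 hY hdrop0 hμσ hσS hσ₀σ hX hYs
  · push Not at hfar
    obtain ⟨i, rfl⟩ := π.surjective q
    by_cases hij : i = j
    · subst hij
      -- The selected server is matched to `q`. If `q` is near the request, moving towards the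
      -- request also approaches `q`, by at least `μ / 2`.
      by_cases hsX : s ≤ X / 4
      · have hconv := dist_moveToward_le (a i) x (c (π i)) hμ0
        rw [← hgj, ← hXdef, hμX', dist_comm x] at hconv
        change u' * X ≤ u * X - μ * (u - s) at hconv
        have htri : X - s ≤ u := by
          have := dist_triangle (a i) (c (π i)) x
          linarith
        have hdrop : μ / 2 ≤ u - u' := by
          rcases hX0.eq_or_lt with h0 | hpos
          · have : μ = 0 := by nlinarith
            have h1 : g i = a i := by
              rw [eq_comm, ← dist_eq_zero, hmj, this]
            have h2 : u' = u := by
              change dist (g i) _ = _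
              rw [h1]
            linarith
          · have : X * (μ / 2) ≤ X * (u - u') := by nlinarith
            exact le_of_mul_le_mul_left this hpos
        exact amortized_of_drop hD hΛ hYD hS0 hY12 hμ0 (by linarith) hσ₀μ hX hYs
      · push Not at hsX
        refine amortized_of_service_large hD hΛ hYD hS0 hδ hY12 hs0 hF hdrop0 hDμ ?_ (b := 4) le_rfl
        have : 4 * s ≤ 4 / δ * s := by
          refine mul_le_mul_of_nonneg_right ?_ hs0
          rw [le_div_iff₀ hδ]
          linarith
        linarith
    -- A follower stands on `q` after the move and is not closer to the request than the selected
    -- server. So `X - μ ≤ s`, and `μ ≤ (1 - δ / 2) * X` gives `X ≤ 2 / δ * s`.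
    · refine amortized_of_service_large hD hΛ hYD hS0 hδ hY12 hs0 hF hdrop0 hDμ ?_ (b := 2)
        (by norm_num)
      have hi : i ∈ Finset.univ.erase j := Finset.mem_erase.2 ⟨hij, Finset.mem_univ _⟩
      have h1 := hj i
      rw [hgi i hi, moveToward_eq_target (hfar i hi).le, hgx] at h1
      change X - μ ≤ s at h1
      rw [div_mul_eq_mul_div, le_div_iff₀ hδ]
      linarith

-- A server that overtakes the selected one must have moved further than `μ` towards its partner. So
-- the weight falls by `S ≥ μ` when all servers follow the matching, and `S` pays for everything.
omit hF in
theorem follow_step_le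
    (hX : dist (a j) x ≤ Λ * D * min ms (1 / D * dist (a j) x) + F)
    (hj : ∀ i, dist (a j) x ≤ dist (a i) x) {i : Fin k} (hij : i ≠ j)
    (hi : dist (greedyMove D ms δ π j a c x i) x < dist (greedyMove D ms δ π j a c x j) x) :
    D * ∑ i, dist (a i) (moveToward (a i) (c (π i)) ((1 + δ) * ms)) +
        dist (moveToward (a j) (c (π j)) ((1 + δ) * ms)) x +
        Y * D * ∑ i, dist (moveToward (a i) (c (π i)) ((1 + δ) * ms)) (c (π i)) ≤
      Y * D * ∑ i, dist (a i) (c (π i)) + F := by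
  have hv : 0 ≤ (1 + δ) * ms := by positivity
  set X := dist (a j) x with hXdef
  have hX0 : 0 ≤ X := dist_nonneg
  have hσ0 := follow_speed_nonneg hD hms hδ hδ1 X hX0
  have hμ0 := greedy_speed_nonneg hD hms hδ hδ1 X hX0
  have hσ₀μ := half_min_le_greedy_speed hD hms hδ hδ1 X hX0
  have hμX := greedy_speed_le_self hD hms hδ hδ1 X hX0
  set μ := min ((1 + δ / 2) * ms) (1 / D * (1 - δ / 2) * X) with hμ
  set σ₀ := min ms (1 / D * X) with hσ₀
  have hgx : dist (greedyMove D ms δ π j a c x j) x = X - μ := by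
    rw [greedyMove_self, dist_moveToward_target _ _ hμ0, ← hXdef, min_eq_left (by nlinarith)]
  have hmove : ∀ i, dist (a i) (moveToward (a i) (c (π i)) ((1 + δ) * ms)) =
      min ((1 + δ) * ms) (dist (a i) (c (π i))) := fun i => dist_self_moveToward _ _ hv
  have htarget : ∀ i, dist (moveToward (a i) (c (π i)) ((1 + δ) * ms)) (c (π i)) =
      dist (a i) (c (π i)) - min ((1 + δ) * ms) (dist (a i) (c (π i))) :=
    fun i => dist_moveToward_target _ _ hv
  have hmin0 : ∀ i, 0 ≤ min ((1 + δ) * ms) (dist (a i) (c (π i))) :=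
    fun i => le_min hv dist_nonneg
  have hserv : dist (moveToward (a j) (c (π j)) ((1 + δ) * ms)) x ≤
      X + min ((1 + δ) * ms) (dist (a j) (c (π j))) := by
    have := dist_triangle_left (moveToward (a j) (c (π j)) ((1 + δ) * ms)) x (a j)
    rw [hmove] at this
    linarith
  simp only [hmove, htarget, Finset.sum_sub_distrib]
  set S := ∑ i, min ((1 + δ) * ms) (dist (a i) (c (π i))) with hS
  have hjS : min ((1 + δ) * ms) (dist (a j) (c (π j))) ≤ S :=
    Finset.single_le_sum (f := fun i => min ((1 + δ) * ms) (dist (a i) (c (π i))))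
      (fun i _ => hmin0 i) (Finset.mem_univ j)
  have hiS : min ((1 + δ) * ms) (dist (a i) (c (π i))) ≤ S :=
    Finset.single_le_sum (f := fun i => min ((1 + δ) * ms) (dist (a i) (c (π i))))
      (fun i _ => hmin0 i) (Finset.mem_univ i)
  have hμS : μ ≤ S := by
    refine le_trans ?_ hiS
    have h1 := dist_triangle (a i) (greedyMove D ms δ π j a c x i) x
    have h2 := hj i
    have h3 : dist (a i) (greedyMove D ms δ π j a c x i) ≤
        min ((1 + δ) * ms) (dist (a i) (c (π i))) := by
      rw [greedyMove_of_ne π j a c x hij, dist_self_moveToward _ _ hσ0]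
      exact min_le_min_right _ (min_le_left _ _)
    linarith
  have hS0 : 0 ≤ S := hμ0.trans hμS
  have hY12 : 12 * Λ ≤ Y := by
    have : 0 < Y := by
      by_contra h
      nlinarith
    nlinarith
  have hDS : 0 ≤ D * S := mul_nonneg (by linarith) hS0
  have h1 : 12 * Λ * (D * S) ≤ Y * (D * S) := mul_le_mul_of_nonneg_right hY12 hDS
  have h2 : D * S ≤ Λ * (D * S) := le_mul_of_one_le_left hDS hΛ
  have h3 : S ≤ D * S := le_mul_of_one_le_left hS0 hD.le
  have h4 : Λ * (D * (σ₀ / 2)) ≤ Λ * (D * S) :=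
    mul_le_mul_of_nonneg_left (mul_le_mul_of_nonneg_left (by linarith) (by linarith))
      (by linarith)
  linarith

end

theorem matchWeight_le {d k : ℕ} (T : TieBreaking d k) (a c : Config d k)
    (τ : Equiv.Perm (Fin k)) : matchWeight T a c ≤ ∑ i, dist (a i) (c (τ i)) :=
  T.matching_min a c τ

theorem matchWeight_le_add {d k : ℕ} (T : TieBreaking d k) (a c c' : Config d k) :
    matchWeight T a c' ≤ matchWeight T a c + ∑ i, dist (c i) (c' i) := by
  refine (matchWeight_le T a c' (T.matching a c)).trans ?_
  rw [← Equiv.sum_comp (T.matching a c) fun i => dist (c i) (c' i), matchWeight,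
    ← Finset.sum_add_distrib]
  exact Finset.sum_le_sum fun i _ => dist_triangle _ _ _

/-- The distance of the selected server, in the steps in which it exceeds `N`. -/
noncomputable def farDist (N x : ℝ) : ℝ := if N < x then x else 0

theorem farDist_nonneg {N x : ℝ} (hx : 0 ≤ x) : 0 ≤ farDist N x := by
  unfold farDist
  split_ifs
  exacts [hx, le_rfl]

theorem le_mul_min_add_farDist {D ms Λ N x : ℝ} (hD : 1 < D) (hΛ : 1 ≤ Λ)
    (hms : 0 < ms)
    (hN : N ≤ Λ * D * ms) (hx : 0 ≤ x) :
    x ≤ Λ * D * min ms (1 / D * x) + farDist N x := by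
  rcases min_cases ms (1 / D * x) with ⟨h, h'⟩ | ⟨h, h'⟩
  · rw [h, farDist]
    split_ifs with hNx
    · exact le_add_of_nonneg_left (by positivity)
    · linarith
  · rw [h]
    have h1 : Λ * D * (1 / D * x) = Λ * x := by field_simp
    have := farDist_nonneg (N := N) hx
    nlinarith

/-- The amortized cost of a step of WMS. -/
theorem wmsStep_cost_le {d k : ℕ} {D ms δ Y Λ N : ℝ} (T : TieBreaking d k) (a c : Config d k)
    (x : Pt d) (hD : 1 < D) (hms : 0 < ms) (hδ : 0 < δ) (hδ1 : δ < 1) (hΛ : 1 ≤ Λ)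
    (hY : Y * δ = 12 * Λ) (hN : N ≤ Λ * D * ms) (q : Fin k) :
    D * ∑ i, dist (a i) (wmsStep D ms δ T a c x i) +
        (⨅ i, dist (wmsStep D ms δ T a c x i) x) +
        Y * D * matchWeight T (wmsStep D ms δ T a c x) c ≤
      Y * D * matchWeight T a c + 12 * Y / δ * dist (c q) x +
        farDist N (dist (a (T.closest a x)) x) := by
  have hY0 : 0 ≤ Y := by
    by_contra h
    nlinarith
  have hF := farDist_nonneg (N := N) (dist_nonneg (x := a (T.closest a x)) (y := x))
  have hX := le_mul_min_add_farDist hD hΛ hms hN (dist_nonneg (x := a (T.closest a x)) (y := x))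
  have hw : Y * D * matchWeight T (wmsStep D ms δ T a c x) c ≤
      Y * D * ∑ i, dist (wmsStep D ms δ T a c x i) (c (T.matching a c i)) :=
    mul_le_mul_of_nonneg_left (matchWeight_le _ _ _ _) (by positivity)
  have hs : (⨅ i, dist (wmsStep D ms δ T a c x i) x) ≤
      dist (wmsStep D ms δ T a c x (T.closest a x)) x :=
    ciInf_le (Set.finite_range _).bddBelow _
  rcases wmsStep_eq_or (D := D) (ms := ms) (δ := δ) T a c x with ⟨h, hj⟩ | ⟨h, i, hij, hi⟩
  · have := greedy_step_le (T.matching a c) (T.closest a x) a c x hD hms hδ hδ1 hΛ hY hF hX hj q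
    rw [← h] at this
    unfold matchWeight at *
    linarith
  · have := follow_step_le (T.matching a c) (T.closest a x) a c x hD hms hδ hδ1 hΛ hY hX
      (T.closest_min a x) hij hi
    have h0 : 0 ≤ 12 * Y / δ * dist (c q) x := by positivity
    rw [h] at hw hs ⊢
    unfold matchWeight at *
    linarith

end MobileServer

namespace MobileServer

/-! Steps in which the request is far from all servers. -/

/-- Aiming at a point `y` near a distant `z` loses at most a fraction `δ / 20` of the step, and `(1
+ δ / 2) * (1 - δ / 20) ≥ 1 + δ / 4`. -/
theorem dist_moveToward_le_sub {d : ℕ} {p y z : Pt d} {v ms δ s : ℝ} (hms : 0 < ms) (hδ : 0 < δ)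
    (hδ1 : δ < 1) (hv : (1 + δ / 2) * ms ≤ v) (hvy : v ≤ dist p y) (hy : dist y z ≤ s)
    (hs : s ≤ δ / 40 * dist p z) :
    dist (moveToward p y v) z ≤ dist p z - (1 + δ / 4) * ms := by
  have hv0 : 0 < v := lt_of_lt_of_le (by positivity) hv
  have h := dist_moveToward_le p y z hv0.le
  rw [min_eq_left hvy] at h
  have hL : 0 < dist p y := hv0.trans_le hvy
  have hLe : dist p y ≤ dist p z + s := (dist_triangle_right p y z).trans (by linarith)
  set L := dist p y
  set e := dist p z
  set f := dist (moveToward p y v) z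
  have h1 : (1 - δ / 20) * L ≤ e - dist y z := by
    have : (1 - δ / 20) * L ≤ (1 - δ / 20) * (e + s) :=
      mul_le_mul_of_nonneg_left hLe (by linarith)
    have hs0 : 0 ≤ s := dist_nonneg.trans hy
    nlinarith
  have h2 : v * ((1 - δ / 20) * L) ≤ v * (e - dist y z) := mul_le_mul_of_nonneg_left h1 hv0.le
  have h3 : (v * (1 - δ / 20)) * L ≤ (e - f) * L := by linarith
  have h4 := le_of_mul_le_mul_right h3 hL
  have h5 : (1 + δ / 2) * ms * (1 - δ / 20) ≤ v * (1 - δ / 20) :=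
    mul_le_mul_of_nonneg_right hv (by linarith)
  have h6 : (1 + δ / 4) * ms ≤ (1 + δ / 2) * ms * (1 - δ / 20) := by
    have : (1 + δ / 4) ≤ (1 + δ / 2) * (1 - δ / 20) := by nlinarith
    nlinarith
  linarith

/-- If the request is far and the pages are near the request, then WMS moves every server closer
to every point in the vicinity of the request. -/
theorem dist_wmsStep_le_sub {d k : ℕ} {D ms δ R : ℝ} (T : TieBreaking d k) (a c : Config d k)
    (x z : Pt d) (hD : 1 < D) (hms : 0 < ms) (hδ : 0 < δ) (hδ1 : δ < 1)
    (hc : ∀ i, dist (c i) x ≤ R) (hX : 4 * D * ms ≤ dist (a (T.closest a x)) x)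
    (hX' : R + 2 * ms ≤ dist (a (T.closest a x)) x) (i : Fin k)
    (hz : R + dist x z ≤ δ / 40 * dist (a i) z) :
    dist (wmsStep D ms δ T a c x i) z ≤ dist (a i) z - (1 + δ / 4) * ms := by
  set X := dist (a (T.closest a x)) x with hXdef
  have hR : 0 ≤ R := dist_nonneg.trans (hc i)
  have hDX : 4 * ms ≤ 1 / D * X := by
    rw [one_div_mul_eq_div, le_div_iff₀ (by linarith)]
    linarith
  have hfollow : dist (moveToward (a i) (c (T.matching a c i)) ((1 + δ) * ms)) z ≤
      dist (a i) z - (1 + δ / 4) * ms := by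
    refine dist_moveToward_le_sub hms hδ hδ1 (by nlinarith) ?_ ?_ hz
    · have h1 := T.closest_min a x i
      have h2 := hc (T.matching a c i)
      have h3 := dist_triangle (a i) (c (T.matching a c i)) x
      nlinarith
    · have h2 := hc (T.matching a c i)
      have h3 := dist_triangle (c (T.matching a c i)) x z
      linarith
  rcases wmsStep_eq_or (D := D) (ms := ms) (δ := δ) T a c x with ⟨h, _⟩ | ⟨h, _⟩
  · rw [h]
    by_cases hi : i = T.closest a x
    · have hmin : min ((1 + δ / 2) * ms) (1 / D * (1 - δ / 2) * X) = (1 + δ / 2) * ms :=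
        min_eq_left (by nlinarith)
      rw [hi, greedyMove_self, ← hXdef, hmin, ← hi]
      refine dist_moveToward_le_sub hms hδ hδ1 le_rfl ?_ (by linarith) hz
      rw [hi, ← hXdef]
      nlinarith
    · have hmin : min ((1 + δ) * ms) (1 / D * X) = (1 + δ) * ms := min_eq_left (by nlinarith)
      rw [greedyMove_of_ne _ _ _ _ _ hi, ← hXdef, hmin]
      exact hfollow
  · rw [h]
    exact hfollow

/-- What the analysis of the far steps needs to know about the servers `a`, where `X t` is the
distance of the closest server to the request `r t`. -/
structure ChasesFar {d k : ℕ} (ms mc δ ρ : ℝ) (r : Requests d) (a : Schedule d k)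
    (X : ℕ → ℝ) : Prop where
  le_dist : ∀ t i, X t ≤ dist (a t i) (r t)
  exists_eq : ∀ t, ∃ i, X t = dist (a t i) (r t)
  succ_le : ∀ t, X (t + 1) ≤ X t + 2 * mc
  progress : ∀ t z i, 8 * ρ ≤ X t → 3 * ρ + dist (r t) z ≤ δ / 40 * dist (a t i) z →
    dist (a (t + 1) i) z ≤ dist (a t i) z - (1 + δ / 4) * ms

/-- All requests of the window stay near the fixed point `r t`, so `progress` applies with `z = r t`
in every step. -/
theorem ChasesFar.dist_le {d k : ℕ} {ms mc δ ρ : ℝ} {r : Requests d} {a : Schedule d k}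
    {X : ℕ → ℝ} (H : ChasesFar ms mc δ ρ r a X) (hδ : 0 < δ) (hδ1 : δ < 1) (hρ : 0 < ρ)
    {t : ℕ} (hX : 1000 * ρ ≤ δ * X t) {i : Fin k} (hi : X t = dist (a t i) (r t)) (m : ℕ)
    (hm : ∀ u, t ≤ u → u < t + m → dist (r u) (r t) < δ * X t / 400 ∧ X t / 2 ≤ X u) :
    dist (a (t + m) i) (r t) ≤ X t - (1 + δ / 4) * (ms * m) := by
  induction m with
  | zero => simp [hi]
  | succ m ih =>
    have h1 := ih fun u hu hu' => hm u hu (by omega)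
    obtain ⟨h2, h3⟩ := hm (t + m) (by omega) (by omega)
    have hXρ : 1000 * ρ ≤ X t := by nlinarith
    have h4 := H.le_dist (t + m) i
    have h5 := dist_triangle_right (a (t + m) i) (r (t + m)) (r t)
    have h6 := H.progress (t + m) (r t) i (by linarith) (by nlinarith)
    push_cast
    rw [← Nat.add_assoc]
    linarith

section
variable {d k : ℕ} {D mc ms δ : ℝ} (hD : 1 < D) (hk : 0 < k) (hmc : 0 < mc) (hms : 0 < ms)
  (hδ : 0 < δ) (hδ1 : δ < 1) {r : Requests d}
  (hr : ∀ t, dist (r t) (r (t + 1)) ≤ mc) {o : Schedule d k} (ho : SpeedAtMost ms o)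
include hD hk hmc hms hδ hδ1 hr ho

/-- If the requests leave the vicinity of `r s` at a high average speed, then this is expensive for
servers of speed at most `ms`. -/
theorem mul_sq_le_cost_of_leave {s e : ℕ} (hse : s ≤ e)
    (hρ : 16 * k * D * mc ≤ dist (r s) (r e))
    (hT : (1 + δ / 8) * (ms * (e - s : ℕ)) ≤ dist (r s) (r e)) :
    39200 * dist (r s) (r e) ^ 2 ≤ 10 ^ 8 * (k * mc / δ ^ 2) *
      ∑ u ∈ Finset.Ico s e, stepCost D r o u := by
  have h1 := mul_dist_request_le_cost hD hk hmc r hr o hse hρ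
  set l := dist (r s) (r e)
  set O := ∑ u ∈ Finset.Ico s e, stepCost D r o u
  have hl0 : 0 ≤ l := dist_nonneg
  have hkm : 0 < k * mc := by positivity
  have hO : 0 ≤ O := le_trans (by positivity) h1
  rw [mul_div_assoc', div_mul_eq_mul_div, le_div_iff₀ (by positivity)]
  -- For smaller `l` the linear bound `h1` is already as strong as the quadratic one.
  by_cases hl : 100 * (k * mc) ≤ δ * l
  · have h2 := mul_sq_dist_request_le_cost hD hk hmc r hr o hms hδ hδ1 ho hse hT hl
    nlinarith [mul_nonneg hkm.le hO]
  · push Not at hl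
    have h3 : l / 2 ≤ O := le_trans (by nlinarith) h1
    have h4 : δ * l * l ≤ 100 * (k * mc) * l := mul_le_mul_of_nonneg_right hl.le hl0
    have h5 : k * mc * (l / 2) ≤ k * mc * O := mul_le_mul_of_nonneg_left h3 hkm.le
    have h6 : δ * (δ * l * l) ≤ δ * l * l := mul_le_of_le_one_left (by positivity) hδ1.le
    nlinarith [mul_nonneg hkm.le hO]

end

end MobileServer

namespace MobileServer

/-! ### Time windows and the quadratic potential `32 * max (X t - N) 0 ^ 2`. -/

theorem farDist_le {N x y : ℝ} (hx : x ≤ y) (hy : 0 ≤ y) : farDist N x ≤ y := by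
  unfold farDist
  split_ifs
  exacts [hx, hy]

theorem farDist_eq_zero {N x : ℝ} (hx : x ≤ N) : farDist N x = 0 := if_neg (not_lt.2 hx)

section
variable {d k : ℕ} {D mc ms δ N : ℝ} (hD : 1 < D) (hk : 0 < k) (hmc : 0 < mc) (hms : 0 < ms)
  (hδ : 0 < δ) (hδ1 : δ < 1) {r : Requests d}
  (hr : ∀ t, dist (r t) (r (t + 1)) ≤ mc) {o : Schedule d k} (ho : SpeedAtMost ms o)
  {a : Schedule d k} {X : ℕ → ℝ} (H : ChasesFar ms mc δ (16 * k * D * mc) r a X)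
  (hN : N * δ = 2000 * (16 * k * D * mc))

section
variable {t m : ℕ} (hX : N ≤ 2 * X t)
  (hm : ∀ u, t ≤ u → u < t + m → dist (r u) (r t) < δ * X t / 400 ∧ X t / 2 ≤ X u)
include hD hk hmc hms hδ hδ1 H hN hX hm

/-- The approach to `r t` cannot go below distance zero, which bounds the length of a window. -/
theorem window_mul_le : ms * m ≤ X t := by
  obtain ⟨i, hi⟩ := H.exists_eq t
  have h1 := H.dist_le hδ hδ1 (by positivity) (by nlinarith) hi m hm
  have h2 := dist_nonneg (x := a (t + m) i) (y := r t)
  have h3 : 0 ≤ ms * m := by positivity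
  nlinarith

omit hms in
theorem window_le : X (t + m) ≤ X t - (1 + δ / 4) * (ms * m) + dist (r t) (r (t + m)) := by
  obtain ⟨i, hi⟩ := H.exists_eq t
  have h1 := H.dist_le hδ hδ1 (by positivity) (by nlinarith) hi m hm
  have h2 := H.le_dist (t + m) i
  have h3 := dist_triangle (a (t + m) i) (r t) (r (t + m))
  linarith

theorem window_farDist_le {u : ℕ} (hu : t ≤ u) (hu' : u < t + m) :
    farDist (4 * N) (X u) ≤ if 2 * N < X t then 2 * X t else 0 := by
  obtain ⟨v, rfl⟩ := Nat.exists_eq_add_of_le hu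
  have h1 := window_le hD hk hmc hδ hδ1 H hN hX (m := v)
    fun w hw hw' => hm w hw (by omega)
  have h2 := (hm (t + v) hu hu').1
  have h3 : 0 ≤ ms * v := by positivity
  rw [dist_comm] at h2
  have hN0 : 0 < N := pos_of_mul_pos_left (by rw [hN]; positivity) hδ.le
  have h4 : X (t + v) ≤ 2 * X t := by nlinarith
  split_ifs with h
  · exact farDist_le h4 (by linarith)
  · exact (farDist_eq_zero (by linarith)).le

theorem window_sum_farDist_le :
    ∑ u ∈ Finset.Ico t (t + m), farDist (4 * N) (X u) ≤
      if 2 * N < X t then 2 * X t * m else 0 := by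
  have h := Finset.sum_le_card_nsmul (Finset.Ico t (t + m)) (fun u => farDist (4 * N) (X u)) _
    fun u hu => window_farDist_le hD hk hmc hms hδ hδ1 H hN hX hm (Finset.mem_Ico.1 hu).1
      (Finset.mem_Ico.1 hu).2
  rw [Nat.card_Ico, add_tsub_cancel_left, nsmul_eq_mul] at h
  refine h.trans_eq ?_
  split_ifs <;> ring

/-- For the last window, cut off by the end of the input: its far steps are paid by the potential at
its start alone. -/
theorem window_sum_le_potential :
    δ * ms * ∑ u ∈ Finset.Ico t (t + m), farDist (4 * N) (X u) ≤ 32 * max (X t - N) 0 ^ 2 := by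
  have h := window_sum_farDist_le hD hk hmc hms hδ hδ1 H hN hX hm
  have h1 := window_mul_le hD hk hmc hms hδ hδ1 H hN hX hm
  have hN0 : 0 < N := pos_of_mul_pos_left (by rw [hN]; positivity) hδ.le
  have hx : 0 ≤ X t := by linarith
  have hms0 : 0 ≤ ms * m := by positivity
  refine (mul_le_mul_of_nonneg_left h (by positivity)).trans ?_
  split_ifs with h2
  · rw [max_eq_left (by linarith)]
    have h3 : δ * ms * (2 * X t * m) ≤ 2 * X t * X t := by
      have : δ * (ms * m) ≤ 1 * X t := mul_le_mul hδ1.le h1 hms0 zero_le_one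
      nlinarith
    nlinarith
  · rw [mul_zero]
    positivity

-- A window ends because the request left the vicinity of `r t` or because `X` halved. The far steps
-- and the change of potential are paid by the fall of `X` or by the offline schedule.
include hr ho in
set_option maxHeartbeats 800000 in
theorem window_complete (hm0 : 0 < m)
    (hend : δ * X t / 400 ≤ dist (r t) (r (t + m)) ∨ X (t + m) < X t / 2) :
    δ * ms * ∑ u ∈ Finset.Ico t (t + m), farDist (4 * N) (X u) +
        32 * max (X (t + m) - N) 0 ^ 2 ≤
      32 * max (X t - N) 0 ^ 2 +
        10 ^ 8 * (k * mc / δ ^ 3) * ∑ u ∈ Finset.Ico t (t + m), stepCost D r o u := by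
  have hsum := window_sum_farDist_le hD hk hmc hms hδ hδ1 H hN hX hm
  have hT := window_mul_le hD hk hmc hms hδ hδ1 H hN hX hm
  have hx1 := window_le hD hk hmc hδ hδ1 H hN hX hm
  have hN0 : 0 < N := pos_of_mul_pos_left (by rw [hN]; positivity) hδ.le
  have hO : 0 ≤ ∑ u ∈ Finset.Ico t (t + m), stepCost D r o u :=
    Finset.sum_nonneg fun u _ => stepCost_nonneg r o u hD
  have hP : 0 ≤ 10 ^ 8 * (k * mc / δ ^ 3) * ∑ u ∈ Finset.Ico t (t + m), stepCost D r o u := by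
    positivity
  have hlmax : dist (r t) (r (t + m)) ≤ δ * X t / 400 + mc := by
    obtain ⟨v, rfl⟩ : ∃ v, m = v + 1 := ⟨m - 1, by omega⟩
    have h1 := (hm (t + v) (by omega) (by omega)).1
    have h2 := dist_triangle_left (r t) (r (t + (v + 1))) (r (t + v))
    have h3 := hr (t + v)
    rw [Nat.add_assoc] at h3
    linarith
  have hρ : mc ≤ 16 * k * D * mc := by
    have hk' : (1 : ℝ) ≤ k := by exact_mod_cast hk
    exact le_mul_of_one_le_left hmc.le (by nlinarith)
  have hleave := fun h1 h2 => mul_sq_le_cost_of_leave hD hk hmc hms hδ hδ1 hr ho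
    (s := t) (e := t + m) (by omega) h1 h2
  rw [add_tsub_cancel_left] at hleave
  set S := ∑ u ∈ Finset.Ico t (t + m), farDist (4 * N) (X u)
  set O := ∑ u ∈ Finset.Ico t (t + m), stepCost D r o u
  set l := dist (r t) (r (t + m)) with hl
  have hl0 : 0 ≤ l := dist_nonneg
  set x := X t
  set x' := X (t + m)
  set τ := ms * (m : ℝ) with hτ
  have hτ0 : 0 ≤ τ := by positivity
  have hx0 : 0 < x := by linarith
  have hδx : 1000 * (16 * k * D * mc) ≤ δ * x := by nlinarith
  have hS : δ * ms * S ≤ if 2 * N < x then 2 * δ * x * τ else 0 := by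
    refine (mul_le_mul_of_nonneg_left hsum (by positivity)).trans_eq ?_
    split_ifs
    · rw [hτ]; ring
    · ring
  clear_value S O l x x' τ
  -- Slow request: `X` falls by `δ / 8 * τ`, and with `x > 2 * N` the potential falls by more than
  -- `2 * δ * x * τ`.
  by_cases hslow : l ≤ (1 + δ / 8) * τ
  · have hx1' : x' ≤ x - δ / 8 * τ := by linarith
    have hδτ : 0 ≤ δ * τ := by positivity
    split_ifs at hS with h2
    · rw [max_eq_left (by linarith : 0 ≤ x - N)]
      have h3 : max (x' - N) 0 ≤ x - N - δ / 8 * τ := max_le (by linarith) (by nlinarith)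
      have h4 : max (x' - N) 0 ^ 2 ≤ (x - N - δ / 8 * τ) ^ 2 :=
        pow_le_pow_left₀ (le_max_right _ _) h3 2
      have h5 : δ * τ * (x / 2) ≤ δ * τ * (x - N) := mul_le_mul_of_nonneg_left (by linarith) hδτ
      have h6 : δ * τ * (δ * τ) ≤ δ * τ * x := mul_le_mul_of_nonneg_left (by nlinarith) hδτ
      nlinarith
    · have h3 : max (x' - N) 0 ^ 2 ≤ max (x - N) 0 ^ 2 :=
        pow_le_pow_left₀ (le_max_right _ _) (max_le_max_right _ (by linarith)) 2
      linarith
  · push Not at hslow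
    -- Fast request that left the vicinity: far steps cost at most `2 * x * l`, the potential rises
    -- by at most `32 * 3 * x * l`, and `98 * x * l ≤ 39200 * l ^ 2 / δ`.
    by_cases hB : δ * x / 400 ≤ l
    · have h1 := hleave (by linarith) hslow.le
      have hlx : l ≤ x := by
        have : δ * x ≤ x := mul_le_of_le_one_left hx0.le hδ1.le
        linarith
      have hτl : τ ≤ l := by
        have : 0 ≤ δ / 8 * τ := by positivity
        linarith
      have hS' : δ * ms * S ≤ 2 * (x * l) := by
        refine hS.trans ?_
        split_ifs
        · have h2 : x * τ ≤ x * l := mul_le_mul_of_nonneg_left hτl hx0.le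
          have h3 : δ * (x * τ) ≤ x * τ := mul_le_of_le_one_left (by positivity) hδ1.le
          linarith
        · positivity
      have hf : max (x' - N) 0 ≤ max (x - N) 0 + l := by
        refine max_le ?_ (by positivity)
        have := le_max_left (x - N) 0
        have : 0 ≤ (1 + δ / 4) * τ := by positivity
        linarith
      have hfx : max (x - N) 0 ≤ x := max_le (by linarith) hx0.le
      have hf2 : max (x' - N) 0 ^ 2 ≤ (max (x - N) 0 + l) ^ 2 :=
        pow_le_pow_left₀ (le_max_right _ _) hf 2
      have h4 : max (x - N) 0 * l ≤ x * l := mul_le_mul_of_nonneg_right hfx hl0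
      have h5 : l * l ≤ x * l := mul_le_mul_of_nonneg_right hlx hl0
      have h6 : x * l ≤ 400 * l ^ 2 / δ := by
        rw [le_div_iff₀ hδ]
        have := mul_le_mul_of_nonneg_right hB hl0
        linarith
      have h7 : 98 * (400 * l ^ 2 / δ) ≤ 10 ^ 8 * (k * mc / δ ^ 3) * O := by
        calc 98 * (400 * l ^ 2 / δ) = (39200 * l ^ 2) / δ := by ring
          _ ≤ (10 ^ 8 * (k * mc / δ ^ 2) * O) / δ := by gcongr
          _ = _ := by field_simp
      nlinarith
    -- Otherwise `X` halved, and the potential falls by at least `8 * x ^ 2` if `x > 2 * N`.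
    · have hhalf : x' < x / 2 := hend.resolve_left hB
      split_ifs at hS with h2
      · rw [max_eq_left (by linarith : 0 ≤ x - N)]
        have h3 : max (x' - N) 0 ≤ x - N - x / 2 := max_le (by linarith) (by linarith)
        have h4 : max (x' - N) 0 ^ 2 ≤ (x - N - x / 2) ^ 2 :=
          pow_le_pow_left₀ (le_max_right _ _) h3 2
        have h5 : δ * (x * τ) ≤ x * x := by
          have : δ * (x * τ) ≤ x * τ := mul_le_of_le_one_left (by positivity) hδ1.le
          nlinarith
        nlinarith
      · rw [max_eq_right (by linarith : x' - N ≤ 0)]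
        have : 0 ≤ max (x - N) 0 ^ 2 := by positivity
        linarith

end

include hD hk hmc hms hδ hδ1 hr ho H hN in
theorem sum_farDist_Ico_le (n m : ℕ) : ∀ t, t + m = n →
    δ * ms * ∑ u ∈ Finset.Ico t n, farDist (4 * N) (X u) ≤
      32 * max (X t - N) 0 ^ 2 +
        10 ^ 8 * (k * mc / δ ^ 3) * ∑ u ∈ Finset.Ico t n, stepCost D r o u := by
  have hP : 0 ≤ 10 ^ 8 * (k * mc / δ ^ 3) := by positivity
  have hO : ∀ t, 0 ≤ ∑ u ∈ Finset.Ico t n, stepCost D r o u := fun t =>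
    Finset.sum_nonneg fun u _ => stepCost_nonneg r o u hD
  have hN0 : 0 < N := pos_of_mul_pos_left (by rw [hN]; positivity) hδ.le
  have hmcN : 4 * mc ≤ N := by
    have hk' : (1 : ℝ) ≤ k := by exact_mod_cast hk
    have h1 : mc ≤ 16 * k * D * mc := le_mul_of_one_le_left hmc.le (by nlinarith)
    nlinarith
  induction m using Nat.strong_induction_on with
  | _ m ih =>
  intro t htn
  rcases Nat.eq_zero_or_pos m with rfl | hm0
  · obtain rfl : t = n := by simpa using htn
    simp only [Finset.Ico_self, Finset.sum_empty, mul_zero, add_zero]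
    positivity
  by_cases hX : N ≤ 2 * X t
  · have hex : ∃ v, 0 < v ∧ (m ≤ v ∨ δ * X t / 400 ≤ dist (r t) (r (t + v)) ∨
        X (t + v) < X t / 2) := ⟨m, hm0, Or.inl le_rfl⟩
    classical
    set v := Nat.find hex with hv
    obtain ⟨hv0, hvend⟩ := Nat.find_spec hex
    rw [← hv] at hv0 hvend
    have hvm : v ≤ m := Nat.find_min' hex ⟨hm0, Or.inl le_rfl⟩
    have hwin : ∀ u, t ≤ u → u < t + v → dist (r u) (r t) < δ * X t / 400 ∧ X t / 2 ≤ X u := by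
      intro u hu hu'
      obtain ⟨w, rfl⟩ := Nat.exists_eq_add_of_le hu
      rcases Nat.eq_zero_or_pos w with rfl | hw
      · have : 0 < X t := by linarith
        rw [add_zero, dist_self]
        exact ⟨by positivity, by linarith⟩
      · have := Nat.find_min hex (show w < Nat.find hex by omega)
        push Not at this
        have := (this hw).2
        rw [dist_comm]
        exact this
    by_cases hvm' : v = m
    · have h := window_sum_le_potential hD hk hmc hms hδ hδ1 H hN hX hwin
      rw [hvm', htn] at h
      exact h.trans (le_add_of_nonneg_right (mul_nonneg hP (hO t)))
    · have h1 := window_complete hD hk hmc hms hδ hδ1 hr ho H hN hX hwin hv0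
        (hvend.resolve_left (by omega))
      have h2 := ih (m - v) (by omega) (t + v) (by omega)
      rw [← Finset.sum_Ico_consecutive _ (by omega : t ≤ t + v) (by omega : t + v ≤ n),
        ← Finset.sum_Ico_consecutive (stepCost D r o) (by omega : t ≤ t + v)
          (by omega : t + v ≤ n)]
      linarith
  -- Here `X t < N / 2`: the step is not far, and `X (t + 1) ≤ N` keeps the potential zero.
  · push Not at hX
    have h1 := H.succ_le t
    have h2 := ih (m - 1) (by omega) (t + 1) (by omega)
    rw [max_eq_right (by linarith : X (t + 1) - N ≤ 0)] at h2
    rw [Finset.sum_eq_sum_Ico_succ_bot (by omega : t < n),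
      Finset.sum_eq_sum_Ico_succ_bot (by omega : t < n), farDist_eq_zero (by linarith)]
    have h3 : 0 ≤ max (X t - N) 0 ^ 2 := by positivity
    have h4 := mul_nonneg hP (stepCost_nonneg r o t hD)
    linarith

end

end MobileServer

namespace MobileServer

/-! The cost of WMS on a local request sequence. -/

section
variable {d k : ℕ} {D mc ms δ : ℝ} (T : TieBreaking d k) (r : Requests d) (c : Schedule d k)

/-- The distance of the server selected by WMS to the request. -/
noncomputable def selectedDist (T : TieBreaking d k) (r : Requests d) (a : Schedule d k)
    (t : ℕ) : ℝ := dist (a t (T.closest (a t) (r t))) (r t)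

section
variable (hD : 1 < D) (hk : 0 < k) (hms : 0 < ms) (hδ : 0 < δ) (hδ1 : δ < 1)
include hD hms hδ hδ1

theorem speedAtMost_wmsSchedule : SpeedAtMost ((1 + δ) * ms) (wmsSchedule D ms δ T r c) :=
  fun t i => dist_wmsStep_le T (wmsSchedule D ms δ T r c t) (c (t + 1)) (r t) hD hms hδ hδ1 i

include hk in
theorem cost_wmsSchedule_le {Y Λ N : ℝ} (hΛ : 1 ≤ Λ) (hY : Y * δ = 12 * Λ)
    (hN : N ≤ Λ * D * ms) (n : ℕ) :
    cost D r (wmsSchedule D ms δ T r c) n ≤ Y * D * ∑ t ∈ Finset.range n, moved c t +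
      12 * Y / δ * ∑ t ∈ Finset.range n, service r c t +
      ∑ t ∈ Finset.range n, farDist N (selectedDist T r (wmsSchedule D ms δ T r c) t) := by
  set a := wmsSchedule D ms δ T r c with ha
  have hY0 : 0 ≤ Y := by
    by_contra h
    nlinarith
  have hYD : 0 ≤ Y * D := by positivity
  have key : ∀ n, cost D r a n + Y * D * matchWeight T (a n) (c n) ≤
      Y * D * ∑ t ∈ Finset.range n, moved c t +
      12 * Y / δ * ∑ t ∈ Finset.range n, service r c t +
      ∑ t ∈ Finset.range n, farDist N (selectedDist T r a t) := by
    intro n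
    induction n with
    | zero =>
      have h1 : matchWeight T (a 0) (c 0) ≤ 0 := by
        refine (matchWeight_le T (a 0) (c 0) 1).trans_eq (Finset.sum_eq_zero fun i _ => ?_)
        exact dist_self (c 0 i)
      have h2 := mul_nonpos_of_nonneg_of_nonpos hYD h1
      simpa [cost] using h2
    | succ n ih =>
      obtain ⟨q, hq⟩ := exists_service_eq r c n hk
      have h1 := wmsStep_cost_le T (a n) (c (n + 1)) (r n) hD hms hδ hδ1 hΛ hY hN q
      have h2 := mul_le_mul_of_nonneg_left (matchWeight_le_add T (a n) (c n) (c (n + 1))) hYD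
      have h3 : stepCost D r a n + Y * D * matchWeight T (a (n + 1)) (c (n + 1)) ≤
          Y * D * matchWeight T (a n) (c (n + 1)) + 12 * Y / δ * service r c n +
            farDist N (selectedDist T r a n) := by
        rw [← hq]
        exact h1
      change Y * D * matchWeight T (a n) (c (n + 1)) ≤
        Y * D * (matchWeight T (a n) (c n) + moved c n) at h2
      rw [cost_eq_sum] at ih ⊢
      simp only [Finset.sum_range_succ]
      linarith
  have h0 : 0 ≤ Y * D * matchWeight T (a n) (c n) :=
    mul_nonneg hYD (Finset.sum_nonneg fun i _ => dist_nonneg)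
  linarith [key n]

include hk in
theorem chasesFar_wmsSchedule (hmc : (1 + δ) * ms ≤ mc)
    (hr : ∀ t, dist (r t) (r (t + 1)) ≤ mc) :
    ChasesFar ms mc δ (16 * k * D * mc) r
      (wmsSchedule D ms δ T r (projSchedule (16 * k * D * mc) r c))
      (selectedDist T r (wmsSchedule D ms δ T r (projSchedule (16 * k * D * mc) r c))) := by
  have hmm : ms ≤ mc := by nlinarith
  have hmc0 : 0 < mc := by linarith
  have hk' : (1 : ℝ) ≤ k := by exact_mod_cast hk
  have hDk : D * mc ≤ k * (D * mc) := le_mul_of_one_le_left (by positivity) hk'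
  have hDms : D * ms ≤ D * mc := mul_le_mul_of_nonneg_left hmm (by linarith)
  have hmD : ms ≤ D * ms := le_mul_of_one_le_left hms.le hD.le
  refine ⟨fun t i => T.closest_min _ _ i, fun t => ⟨_, rfl⟩, fun t => ?_, fun t z i hX hz => ?_⟩
  · set a := wmsSchedule D ms δ T r (projSchedule (16 * k * D * mc) r c) with ha
    set i := T.closest (a t) (r t) with hi
    have h1 := T.closest_min (a (t + 1)) (r (t + 1)) i
    have h2 := dist_triangle4 (a (t + 1) i) (a t i) (r t) (r (t + 1))
    have h3 := speedAtMost_wmsSchedule T r (projSchedule (16 * k * D * mc) r c) hD hms hδ hδ1 t i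
    rw [← ha, dist_comm] at h3
    have h4 := hr t
    unfold selectedDist
    rw [← hi]
    linarith
  · exact dist_wmsStep_le_sub T _ _ (r t) z hD hms hδ hδ1
      (fun i => dist_projSchedule_request_le r c (by positivity) t i)
      (le_trans (by linarith) hX) (le_trans (by linarith) hX) i hz

end

section
variable (hD : 1 < D) (hk : 0 < k) (hms : 0 < ms) (hδ : 0 < δ) (hδ1 : δ < 1)
  (hmc : (1 + δ) * ms ≤ mc) (hr : ∀ t, dist (r t) (r (t + 1)) ≤ mc) (o : Schedule d k)
  (ho : SpeedAtMost ms o)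
include hD hk hms hδ hδ1 hmc hr ho

/-- On short inputs with a distant first request every schedule of bounded speed is good. -/
theorem cost_le_of_short {a : Schedule d k} (ha : SpeedAtMost ((1 + δ) * ms) a)
    (hao : a 0 = o 0) {j : Fin k} (hj : ∀ i, dist (a 0 j) (r 0) ≤ dist (a 0 i) (r 0))
    (hL : 2 * k * D * mc ≤ dist (a 0 j) (r 0)) {n : ℕ} (hn : n * (4 * mc) ≤ dist (a 0 j) (r 0)) :
    cost D r a n ≤ 6 * cost D r o n := by
  have hmm : ms ≤ mc := by nlinarith
  have hmc0 : 0 < mc := by linarith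
  rw [cost_eq_sum, cost_eq_sum, Finset.mul_sum]
  refine Finset.sum_le_sum fun t ht => ?_
  set L := dist (a 0 j) (r 0)
  have htn : ((t : ℝ) + 1) ≤ n := by exact_mod_cast Finset.mem_range.1 ht
  have htL : (t + 1) * (4 * mc) ≤ L :=
    (mul_le_mul_of_nonneg_right htn (by positivity)).trans hn
  have h1 := le_service_of_speed hk r hr o hmm ho (by rwa [← hao]) t
  have h2 := service_le_stepCost r o t hD
  have h3 : service r a t ≤ L + (2 * t + 1) * mc := by
    have e1 := service_le r a t j
    have e2 := dist_zero_le_of_speed a ha j (t + 1)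
    have e3 := dist_request_zero_le r hr t
    have e4 := dist_triangle4 (a (t + 1) j) (a 0 j) (r 0) (r t)
    rw [dist_comm (a (t + 1) j) (a 0 j)] at e4
    have e5 : ((t : ℝ) + 1) * ((1 + δ) * ms) ≤ (t + 1) * mc :=
      mul_le_mul_of_nonneg_left hmc (by positivity)
    push_cast at e2
    linarith
  have h4 : D * moved a t ≤ L / 2 := by
    have e1 : moved a t ≤ k * mc := by
      have := Finset.sum_le_card_nsmul Finset.univ (fun i => dist (a t i) (a (t + 1) i)) mc
        fun i _ => (ha t i).trans hmc
      rwa [Finset.card_univ, Fintype.card_fin, nsmul_eq_mul] at this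
    have e2 : D * moved a t ≤ D * (k * mc) := mul_le_mul_of_nonneg_left e1 (by linarith)
    linarith
  have h5 : 0 ≤ L := dist_nonneg
  unfold stepCost at *
  linarith

omit hD hr hδ1 ho in
theorem one_le_ratio : 1 ≤ k * (mc / ms) := by
  have hk' : (1 : ℝ) ≤ k := by exact_mod_cast hk
  have h1 : 1 ≤ mc / ms := by
    rw [le_div_iff₀ hms]
    nlinarith
  exact one_le_mul_of_one_le_of_one_le hk' h1

/-- `hf` pays for the initial quadratic potential and `hL` for the first move of the projected
pages; these are the only places where the distance of the first request enters. -/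
theorem cost_wms_le_of_start {G : ℝ} (hG : ∀ i j, dist (c 0 i) (c 0 j) ≤ G)
    (n : ℕ) {j : Fin k}
    (hf : max (dist (c 0 j) (r 0) - 32000 * k * D * mc / δ) 0 ^ 2 ≤ 16 * mc * cost D r o n)
    (hL : D * dist (c 0 j) (r 0) ≤ 4 * cost D r c n + D * (32000 * k * D * mc / δ)) :
    cost D r (wmsSchedule D ms δ T r (projSchedule (16 * k * D * mc) r c)) n ≤
      10 ^ 8 * (1 / δ ^ 3 * k ^ 2 * (mc / ms)) * cost D r c n +
      2 * 10 ^ 8 * (1 / δ ^ 4 * k ^ 2 * (mc / ms)) * cost D r o n +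
      1536000 * k * mc / (δ ^ 2 * ms) * k * D *
        (192 * k * D * mc + 32000 * k * D * mc / δ + G) := by
  have hmm : ms ≤ mc := by nlinarith
  have hmc0 : 0 < mc := by linarith
  have hk' : (1 : ℝ) ≤ k := by exact_mod_cast hk
  have hratio := one_le_ratio (δ := δ) hk hms hδ hmc
  set ρ := 16 * k * D * mc with hρ
  set p := projSchedule ρ r c with hp
  set a := wmsSchedule D ms δ T r p with ha
  -- `N = 2000 * ρ / δ` is the threshold of the windows, `Λ = 4 * N / (D * ms)` fits the far
  -- distance `4 * N`, and `Y = 12 * Λ / δ`.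
  set N := 32000 * k * D * mc / δ with hN
  set Λ := 128000 * k * mc / (δ * ms) with hΛ
  set Y := 1536000 * k * mc / (δ ^ 2 * ms) with hY
  have hNδ : N * δ = 2000 * ρ := by rw [hN, hρ]; field_simp; norm_num
  have hΛ1 : 1 ≤ Λ := by
    rw [hΛ, le_div_iff₀ (by positivity)]
    have h1 : ms ≤ k * mc := hmm.trans (le_mul_of_one_le_left hmc0.le hk')
    have h2 : δ * ms ≤ ms := mul_le_of_le_one_left hms.le hδ1.le
    nlinarith
  have hYΛ : Y * δ = 12 * Λ := by rw [hY, hΛ]; field_simp; norm_num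
  have hNΛ : 4 * N ≤ Λ * D * ms := by
    apply le_of_eq
    rw [hN, hΛ]; field_simp; norm_num
  have hY0 : 0 < Y := by positivity
  have hρ0 : 0 < ρ := by positivity
  have hmcρ : mc ≤ ρ := le_mul_of_one_le_left hmc0.le (by nlinarith)
  have h1 := cost_wmsSchedule_le T r p hD hk hms hδ hδ1 hΛ1 hYΛ hNΛ n
  have h2 := sum_moved_projSchedule_le r c hρ0.le hmcρ hr n
  have h3 := phaseCount_le r c hD hk hmc0 hr n
  have h4 : ∑ t ∈ Finset.range n, service r p t ≤
      3 * ∑ t ∈ Finset.range n, service r c t := by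
    rw [Finset.mul_sum]
    exact Finset.sum_le_sum fun t _ => service_projSchedule_le r c hk hρ0.le t
  have H := chasesFar_wmsSchedule T r c hD hk hms hδ hδ1 hmc hr
  have h5 := sum_farDist_Ico_le hD hk hmc0 hms hδ hδ1 hr ho H hNδ n n 0 (zero_add n)
  rw [← Finset.range_eq_Ico, ← cost_eq_sum, ← hρ, ← hp, ← ha] at h5
  have hX0 : selectedDist T r a 0 ≤ dist (c 0 j) (r 0) := H.le_dist 0 j
  have h6 : max (selectedDist T r a 0 - N) 0 ^ 2 ≤ 16 * mc * cost D r o n :=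
    (pow_le_pow_left₀ (le_max_right _ _) (max_le_max_right _ (by linarith)) 2).trans hf
  have h7 : ∑ i, dist (c 0 i) (r 0) ≤ k * (dist (c 0 j) (r 0) + G) := by
    have := Finset.sum_le_card_nsmul Finset.univ (fun i => dist (c 0 i) (r 0))
      (dist (c 0 j) (r 0) + G) fun i _ => by
        have := dist_triangle (c 0 i) (c 0 j) (r 0)
        have := hG i j
        linarith
    rwa [Finset.card_univ, Fintype.card_fin, nsmul_eq_mul] at this
  have hc : cost D r c n = D * ∑ t ∈ Finset.range n, moved c t +
      ∑ t ∈ Finset.range n, service r c t := by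
    rw [cost_eq_sum, Finset.mul_sum, ← Finset.sum_add_distrib]
    rfl
  have hcm : 0 ≤ ∑ t ∈ Finset.range n, moved c t := Finset.sum_nonneg fun t _ => moved_nonneg c t
  have hcs : 0 ≤ ∑ t ∈ Finset.range n, service r c t :=
    Finset.sum_nonneg fun t _ => service_nonneg r c t
  have hc0 : 0 ≤ cost D r c n := cost_nonneg r c hD n
  have ho0 : 0 ≤ cost D r o n := cost_nonneg r o hD n
  have hfar : ∑ t ∈ Finset.range n, farDist (4 * N) (selectedDist T r a t) ≤
      2 * 10 ^ 8 * (1 / δ ^ 4 * k ^ 2 * (mc / ms)) * cost D r o n := by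
    have e1 : δ * ms * ∑ t ∈ Finset.range n, farDist (4 * N) (selectedDist T r a t) ≤
        (512 * mc + 10 ^ 8 * (k * mc / δ ^ 3)) * cost D r o n := by linarith
    have e2 : 512 * mc + 10 ^ 8 * (k * mc / δ ^ 3) ≤ 2 * 10 ^ 8 * (k ^ 2 * mc / δ ^ 3) := by
      have i1 : mc ≤ k * mc := le_mul_of_one_le_left hmc0.le hk'
      have i2 : k * mc ≤ k * mc / δ ^ 3 := by
        rw [le_div_iff₀ (by positivity)]
        exact mul_le_of_le_one_right (by positivity) (pow_le_one₀ hδ.le hδ1.le)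
      have i3 : k * mc / δ ^ 3 ≤ k ^ 2 * mc / δ ^ 3 := by
        gcongr
        nlinarith
      linarith
    have e3 := e1.trans (mul_le_mul_of_nonneg_right e2 ho0)
    rw [← le_div_iff₀' (by positivity)] at e3
    refine e3.trans_eq ?_
    field_simp
  have hpage : Y * D * ∑ t ∈ Finset.range n, moved p t +
      12 * Y / δ * ∑ t ∈ Finset.range n, service r p t ≤
      65 * (Y * k / δ) * cost D r c n + Y * k * D * (192 * k * D * mc + N + G) := by
    have hkδ : Y ≤ Y * k / δ ∧ Y * k ≤ Y * k / δ ∧ Y / δ ≤ Y * k / δ := by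
      have i1 : Y ≤ Y * k := le_mul_of_one_le_right hY0.le hk'
      have i2 : Y * k ≤ Y * k / δ := by
        rw [le_div_iff₀ hδ]
        exact mul_le_of_le_one_right (by positivity) hδ1.le
      exact ⟨i1.trans i2, i2, by gcongr⟩
    have e1 : 12 * Y / δ * ∑ t ∈ Finset.range n, service r p t ≤
        36 * (Y / δ) * cost D r c n := by
      have : 0 ≤ D * ∑ t ∈ Finset.range n, moved c t := by positivity
      calc _ ≤ 12 * Y / δ * (3 * cost D r c n) :=
            mul_le_mul_of_nonneg_left (by linarith) (by positivity)
        _ = _ := by ring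
    have e2 : D * (12 * ρ * k * phaseCount ρ r n) ≤ k * (24 * cost D r c n + 12 * D * ρ) := by
      have : 24 * k * (D * ρ / 2 * phaseCount ρ r n) ≤
        24 * k * (cost D r c n + D * ρ / 2) := mul_le_mul_of_nonneg_left h3 (by positivity)
      linarith
    have e3 : D * ∑ i, dist (c 0 i) (r 0) ≤ k * (4 * cost D r c n + D * N + D * G) := by
      have i1 : D * ∑ i, dist (c 0 i) (r 0) ≤ D * (k * (dist (c 0 j) (r 0) + G)) :=
        mul_le_mul_of_nonneg_left h7 (by linarith)
      have i2 : k * (D * dist (c 0 j) (r 0)) ≤ k * (4 * cost D r c n + D * N) :=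
        mul_le_mul_of_nonneg_left hL (by linarith)
      linarith
    have e4 : D * ∑ t ∈ Finset.range n, moved p t ≤ cost D r c n +
        k * (24 * cost D r c n + 12 * D * ρ) + k * (4 * cost D r c n + D * N + D * G) := by
      have := mul_le_mul_of_nonneg_left h2 (show 0 ≤ D by linarith)
      linarith
    have e5 := mul_le_mul_of_nonneg_left e4 hY0.le
    have e6 := mul_le_mul_of_nonneg_right hkδ.1 hc0
    have e7 := mul_le_mul_of_nonneg_right hkδ.2.1 hc0
    have e8 := mul_le_mul_of_nonneg_right hkδ.2.2 hc0
    rw [hρ] at e5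
    linarith
  have hcoef : 65 * (Y * k / δ) * cost D r c n ≤
      10 ^ 8 * (1 / δ ^ 3 * k ^ 2 * (mc / ms)) * cost D r c n := by
    refine mul_le_mul_of_nonneg_right ?_ hc0
    have : 65 * (Y * k / δ) = 99840000 * (1 / δ ^ 3 * k ^ 2 * (mc / ms)) := by
      rw [hY]; field_simp; norm_num
    rw [this]
    exact mul_le_mul_of_nonneg_right (by norm_num) (by positivity)
  linarith

/-- The cost of WMS in terms of the costs of the simulated schedule and of an arbitrary schedule
of speed at most `ms`. -/
theorem cost_wms_le {G : ℝ} (hG : ∀ i j, dist (c 0 i) (c 0 j) ≤ G) (hoc : o 0 = c 0) (n : ℕ) :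
    cost D r (wmsSchedule D ms δ T r (projSchedule (16 * k * D * mc) r c)) n ≤
      10 ^ 8 * (1 / δ ^ 3 * k ^ 2 * (mc / ms)) * cost D r c n +
      2 * 10 ^ 8 * (1 / δ ^ 4 * k ^ 2 * (mc / ms)) * cost D r o n +
      1536000 * k * mc / (δ ^ 2 * ms) * k * D *
        (192 * k * D * mc + 32000 * k * D * mc / δ + G) := by
  have hmm : ms ≤ mc := by nlinarith
  have hmc0 : 0 < mc := by linarith
  have hk' : (1 : ℝ) ≤ k := by exact_mod_cast hk
  have hratio := one_le_ratio (δ := δ) hk hms hδ hmc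
  have hc0 : 0 ≤ cost D r c n := cost_nonneg r c hD n
  have ho0 : 0 ≤ cost D r o n := cost_nonneg r o hD n
  set j := T.closest (c 0) (r 0)
  have hj : ∀ i, dist (c 0 j) (r 0) ≤ dist (c 0 i) (r 0) := T.closest_min _ _
  set L := dist (c 0 j) (r 0) with hLdef
  have hL0 : 0 ≤ L := dist_nonneg
  have hbase : 0 < k * D * mc := by positivity
  have hN : 32000 * (k * D * mc) ≤ 32000 * k * D * mc / δ := by
    rw [le_div_iff₀ hδ]
    nlinarith
  have hmck : mc ≤ k * D * mc := le_mul_of_one_le_left hmc0.le (by nlinarith)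
  -- A near first request goes into the additive constant. A far one is paid by `o` and `c` if the
  -- input is long, and `cost_le_of_short` treats the short inputs.
  rcases le_or_gt L (32000 * k * D * mc / δ) with hLN | hLN
  · refine cost_wms_le_of_start T r c hD hk hms hδ hδ1 hmc hr o ho hG n (j := j) ?_ ?_
    · rw [← hLdef, max_eq_right (by linarith), zero_pow two_ne_zero]
      positivity
    · rw [← hLdef]
      have := mul_le_mul_of_nonneg_left hLN (show 0 ≤ D by linarith)
      linarith
  rcases le_or_gt L (n * (4 * mc)) with hn | hn
  · refine cost_wms_le_of_start T r c hD hk hms hδ hδ1 hmc hr o ho hG n (j := j) ?_ ?_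
    · rw [← hLdef, max_eq_left (by linarith)]
      have h1 := sq_le_cost_of_speed hD hk hmc0 r hr o hmm ho (by rwa [hoc]) (by linarith) hn
      refine le_trans (pow_le_pow_left₀ (by linarith) ?_ 2) h1
      linarith
    · rw [← hLdef]
      have h1 := mul_le_cost_of_far_start hD hk hmc0 r hr c hj (by linarith) hn
      have : 0 ≤ D * (32000 * k * D * mc / δ) := by positivity
      linarith
  · have hG0 : 0 ≤ G := dist_nonneg.trans (hG j j)
    have hspeed := speedAtMost_wmsSchedule T r (projSchedule (16 * k * D * mc) r c) hD hms hδ hδ1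
    have h1 := cost_le_of_short r hD hk hms hδ hδ1 hmc hr o ho hspeed hoc.symm hj
      (by change _ ≤ L; linarith) (by change _ ≤ L; exact hn.le)
    have h2 : 1 ≤ 1 / δ ^ 4 * k ^ 2 * (mc / ms) := by
      have i1 : 1 ≤ 1 / δ ^ 4 := by
        rw [le_div_iff₀ (by positivity), one_mul]
        exact pow_le_one₀ hδ.le hδ1.le
      have i2 : 1 ≤ k * (k * (mc / ms)) := one_le_mul_of_one_le_of_one_le hk' hratio
      calc 1 ≤ 1 / δ ^ 4 * (k * (k * (mc / ms))) := one_le_mul_of_one_le_of_one_le i1 i2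
        _ = _ := by ring
    have h3 : 6 * cost D r o n ≤
        2 * 10 ^ 8 * (1 / δ ^ 4 * k ^ 2 * (mc / ms)) * cost D r o n :=
      mul_le_mul_of_nonneg_right (by linarith) ho0
    have h4 : 0 ≤ 10 ^ 8 * (1 / δ ^ 3 * k ^ 2 * (mc / ms)) * cost D r c n := by positivity
    have h5 : 0 ≤ 1536000 * k * mc / (δ ^ 2 * ms) * k * D *
        (192 * k * D * mc + 32000 * k * D * mc / δ + G) := by positivity
    linarith

end
end

end MobileServer

namespace MobileServer

/-! Optimal offline costs and the competitive ratio. -/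

section
variable {d k : ℕ} {D ms : ℝ} (x₀ : Config d k) (r : Requests d) (n : ℕ)

theorem pageOpt_le (hD : 1 < D) {s : Schedule d k} (hs : s 0 = x₀) :
    pageOpt D x₀ r n ≤ cost D r s n :=
  csInf_le ⟨0, by rintro _ ⟨s, _, rfl⟩; exact cost_nonneg r s hD n⟩ ⟨s, hs, rfl⟩

theorem le_pageOpt {y : ℝ} (h : ∀ s : Schedule d k, s 0 = x₀ → y ≤ cost D r s n) :
    y ≤ pageOpt D x₀ r n :=
  le_csInf ⟨_, fun _ => x₀, rfl, rfl⟩ (by rintro _ ⟨s, hs, rfl⟩; exact h s hs)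

theorem le_mobileOpt (hms : 0 < ms) {y : ℝ}
    (h : ∀ s : Schedule d k, s 0 = x₀ → SpeedAtMost ms s → y ≤ cost D r s n) :
    y ≤ mobileOpt D ms x₀ r n :=
  le_csInf ⟨_, fun _ => x₀, rfl, fun _ _ => by simpa using hms.le, rfl⟩
    (by rintro _ ⟨s, hs, hv, rfl⟩; exact h s hs hv)

theorem cost_congr {r' : Requests d} (h : ∀ t < n, r t = r' t) {s s' : Schedule d k}
    (hs : ∀ t ≤ n, s t = s' t) : cost D r s n = cost D r' s' n :=
  Finset.sum_congr rfl fun t ht => by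
    have ht := Finset.mem_range.1 ht
    rw [h t ht, hs t ht.le, hs (t + 1) ht]

theorem mobileOpt_congr {r' : Requests d} (h : ∀ t < n, r t = r' t) :
    mobileOpt D ms x₀ r n = mobileOpt D ms x₀ r' n := by
  unfold mobileOpt
  simp only [cost_congr r n h fun _ _ => rfl]

theorem OnlineAlg.cost_congr {x₀ : Config d k} (A : OnlineAlg x₀) {r r' : Requests d}
    (h : ∀ t < n, r t = r' t) : cost D r (A.run r) n = cost D r' (A.run r') n :=
  MobileServer.cost_congr r n h fun t ht => A.causal r r' t fun s hs => h s (by omega)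

end

/-- For local inputs it suffices to consider request sequences that are local forever. -/
theorem MobileCompetitive.of_local {d k : ℕ} {x₀ : Config d k} {D ms mc : ℝ} (hmc : 0 ≤ mc)
    {A : OnlineAlg x₀} {c α : ℝ}
    (h : ∀ (r : Requests d) (n : ℕ), (∀ t, dist (r t) (r (t + 1)) ≤ mc) →
      cost D r (A.run r) n ≤ c * mobileOpt D ms x₀ r n + α) :
    MobileCompetitive D ms mc A c := by
  refine ⟨α, fun r n hr => ?_⟩
  -- The last request of the input is repeated forever; this affects neither the cost nor the
  -- optimum of the first `n` steps.
  have heq : ∀ t < n, r t = r (min t (n - 1)) := fun t ht => by rw [min_eq_left (by omega)]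
  rw [A.cost_congr n heq, mobileOpt_congr x₀ r n heq]
  refine h (fun t => r (min t (n - 1))) n fun t => ?_
  rcases lt_or_ge (t + 1) n with ht | ht
  · rw [min_eq_left (by omega), min_eq_left (by omega)]
    exact hr t ht
  · rw [min_eq_right (by omega), min_eq_right (by omega), dist_self]
    exact hmc

theorem exists_far_point {d k : ℕ} (hd : 0 < d) (x₀ : Config d k) (B : ℝ) :
    ∃ v : Pt d, ∀ i, B ≤ dist (x₀ i) v := by
  refine ⟨EuclideanSpace.single ⟨0, hd⟩ (B + ∑ i, ‖x₀ i‖), fun i => ?_⟩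
  have h1 : ‖x₀ i‖ ≤ ∑ i, ‖x₀ i‖ :=
    Finset.single_le_sum (f := fun i => ‖x₀ i‖) (fun _ _ => norm_nonneg _) (Finset.mem_univ i)
  have h2 := norm_sub_norm_le (EuclideanSpace.single ⟨0, hd⟩ (B + ∑ i, ‖x₀ i‖) : Pt d) (x₀ i)
  rw [PiLp.norm_single, Real.norm_eq_abs] at h2
  rw [dist_comm, dist_eq_norm]
  linarith [le_abs_self (B + ∑ i, ‖x₀ i‖)]

/-- Every competitive ratio for page migration is nonnegative, as a single request can be
arbitrarily expensive. -/
theorem PageCompetitive.nonneg {d k : ℕ} {x₀ : Config d k} {D c : ℝ} {K : OnlineAlg x₀}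
    (hd : 0 < d) (hk : 0 < k) (hD : 1 < D) (h : PageCompetitive D K c) : 0 ≤ c := by
  obtain ⟨α, h⟩ := h
  by_contra! hc
  obtain ⟨v, hv⟩ := exists_far_point hd x₀ ((α + 1) / -c)
  have h1 : (α + 1) / -c ≤ pageOpt D x₀ (fun _ => v) 1 := by
    refine le_pageOpt x₀ _ 1 fun s hs => ?_
    obtain ⟨i, hi⟩ := exists_service_eq (fun _ => v) s 0 hk
    have h2 := dist_le_moved s 0 i
    have h3 := dist_triangle (s 0 i) (s (0 + 1) i) v
    have h4 := moved_nonneg s 0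
    have h5 := hv i
    rw [cost_eq_sum, Finset.sum_range_one, stepCost]
    rw [← hs] at h5
    nlinarith
  have h2 := h (fun _ => v) 1
  have h3 := cost_nonneg (fun _ => v) (K.run fun _ => v) hD 1
  rw [div_le_iff₀ (by linarith)] at h1
  linarith

theorem mobileCompetitive_of_dim_zero {k : ℕ} {x₀ : Config 0 k} {D ms mc : ℝ} (hms : 0 < ms)
    (A : OnlineAlg x₀) (c : ℝ) : MobileCompetitive D ms mc A c := by
  have h0 : ∀ r (s : Schedule 0 k) n, cost D r s n = 0 := fun r s n => by
    have h : ∀ x y : Pt 0, dist x y = 0 := fun x y => by rw [Subsingleton.elim x y, dist_self]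
    simp only [cost, h, Finset.sum_const_zero, mul_zero, Real.iInf_const_zero, add_zero]
  refine ⟨0, fun r n _ => ?_⟩
  have hopt : mobileOpt D ms x₀ r n = 0 := by
    have : {y | ∃ s : Schedule 0 k, s 0 = x₀ ∧ SpeedAtMost ms s ∧ y = cost D r s n} = {0} := by
      ext y
      constructor
      · rintro ⟨s, _, _, rfl⟩
        exact h0 r s n
      · rintro rfl
        exact ⟨fun _ => x₀, rfl, fun _ _ => by simpa using hms.le, (h0 r _ n).symm⟩
    rw [mobileOpt, this, csInf_singleton]
  rw [h0, hopt]
  simp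

end MobileServer

theorem mainTheorem2 :
    ∃ C : ℝ, 0 < C ∧
      ∀ (d k : ℕ) (D ms mc δ : ℝ), 0 < k → 1 < D → 0 < ms → 0 < δ → δ < 1 →
        (1 + δ) * ms ≤ mc →
      ∀ (x₀ : MobileServer.Config d k) (K : MobileServer.OnlineAlg x₀)
        (T : MobileServer.TieBreaking d k) (c : ℝ), MobileServer.PageCompetitive D K c →
        (∀ r, MobileServer.SpeedAtMost ((1 + δ) * ms)
          ((MobileServer.WMS D ms mc δ T K).run r)) ∧
        MobileServer.MobileCompetitive D ms mc (MobileServer.WMS D ms mc δ T K)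
          (C * (1 / δ ^ 4 * (k : ℝ) ^ 2 * (mc / ms) + 1 / δ ^ 3 * (k : ℝ) ^ 2 * (mc / ms) * c)) := by
  refine ⟨2 * 10 ^ 8, by norm_num, ?_⟩
  intro d k D ms mc δ hk hD hms hδ hδ1 hmc x₀ K T c hK
  refine ⟨fun r => MobileServer.speedAtMost_wmsSchedule T r _ hD hms hδ hδ1, ?_⟩
  -- In dimension zero all costs vanish and `c` may be negative, so `PageCompetitive.nonneg` is not
  -- available.
  rcases Nat.eq_zero_or_pos d with rfl | hd
  · exact MobileServer.mobileCompetitive_of_dim_zero hms _ _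
  have hc := hK.nonneg hd hk hD
  obtain ⟨α, hα⟩ := hK
  have hmc0 : 0 < mc := lt_of_lt_of_le (by positivity) hmc
  set P := 1 / δ ^ 3 * (k : ℝ) ^ 2 * (mc / ms) with hP
  set Q := 1 / δ ^ 4 * (k : ℝ) ^ 2 * (mc / ms) with hQ
  have hP0 : 0 < P := by positivity
  have hQ0 : 0 < Q := by positivity
  set β := 1536000 * k * mc / (δ ^ 2 * ms) * k * D *
    (192 * k * D * mc + 32000 * k * D * mc / δ + ∑ i, ∑ j, dist (x₀ i) (x₀ j)) with hβ
  refine MobileServer.MobileCompetitive.of_local hmc0.le (α := 10 ^ 8 * P * α + β)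
    fun r n hr => ?_
  have hR : 0 < 2 * 10 ^ 8 * (Q + P * c) := by positivity
  rw [← sub_le_iff_le_add, ← div_le_iff₀' hR]
  refine MobileServer.le_mobileOpt x₀ r n hms fun o ho hv => ?_
  rw [div_le_iff₀' hR, sub_le_iff_le_add]
  have hG : ∀ i j, dist (K.run r 0 i) (K.run r 0 j) ≤ ∑ i, ∑ j, dist (x₀ i) (x₀ j) := by
    intro i j
    rw [K.run_zero]
    exact (Finset.single_le_sum (f := fun j => dist (x₀ i) (x₀ j)) (fun _ _ => dist_nonneg)
      (Finset.mem_univ j)).trans (Finset.single_le_sum (f := fun i => ∑ j, dist (x₀ i) (x₀ j))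
        (fun _ _ => Finset.sum_nonneg fun _ _ => dist_nonneg) (Finset.mem_univ i))
  have h1 := MobileServer.cost_wms_le T r (K.run r) hD hk hms hδ hδ1 hmc hr o hv hG
    (ho.trans (K.run_zero r).symm) n
  -- The speed-limited schedule `o` is also admissible for page migration; `0 ≤ c` is needed to
  -- replace `pageOpt` by its cost.
  have h2 : MobileServer.cost D r (K.run r) n ≤ c * MobileServer.cost D r o n + α :=
    (hα r n).trans (add_le_add_left
      (mul_le_mul_of_nonneg_left (MobileServer.pageOpt_le x₀ r n hD ho) hc) α)
  have h3 := mul_le_mul_of_nonneg_left h2 (by positivity : 0 ≤ 10 ^ 8 * P)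
  have h4 : 0 ≤ P * c * MobileServer.cost D r o n :=
    mul_nonneg (by positivity) (MobileServer.cost_nonneg r o hD n)
  rw [← hP, ← hQ, ← hβ] at h1
  change MobileServer.cost D r (MobileServer.wmsSchedule D ms δ T r
    (MobileServer.projSchedule (16 * k * D * mc) r (K.run r))) n ≤ _
  linarith
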